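/- **Setting.** Fix $p\ge 0$, $\psi_1>0$, real $K_e,K_v$, an interval $(a,b)\ni\psi_1$ and constants $M,B\in\mathbb R$, $c>0$. For each $m$ consider the Fay–Herriot model $$y=X\beta+v+\varepsilon\in\mathbb R^m ,$$ with $X$ a known $m\times p$ matrix, $\beta\in\mathbb R^p$, $D=\mathrm{diag}(D_1,\dots,D_m)$ known with $D_i>0$, and $v_1,\dots,v_m,\varepsilon_1,\dots,\varepsilon_m$ independent random variables with $E v_i=E\varepsilon_i=0$, $\mathrm{Var}(v_i)=\psi_1$, $\mathrm{Var}(\varepsilon_i)=D_i$, $E[(v_i/\sqrt{\psi_1})^4]=K_v+3$, $E[(\varepsilon_i/\sqrt{D_i})^4]=K_e+3$, and $E v_i^6\le M$, $E\varepsilon_i^6\le M$. All of $X,\beta,D$ and the distributions may depend on $m$. Put $\Sigma(t)=tI_m+D$ and $\Sigma=\Sigma(\psi_1)$. Let $L(t)$ be a $p\times m$ matrix with $L(t)X=I_p$ (so that $L(t)y$ is a linear unbiased estimator of $\beta$), $Q(t)=I_m-XL(t)$, and let $W_1(t)$ be a diagonal $m\times m$ matrix, for $t\in(a,b)$. Assume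 that, on $(a,b)$ and for all large $m$: the entries of $XL(t)$ and of $W_1(t)$ are three times continuously differentiable in $t$; the entries of $XL(t)$ and of its derivatives up to order $3$ are at most $B/m$ in absolute value; those of $W_1(t)$ and of its derivatives up to order $3$ are at most $B$; and $|\mathrm{tr}\,W_1(t)|\ge c\,m$. Let $\widehat\psi_1$ be a real random variable that lies in $(a,b)$ and solves the estimating equation $$y^\top Q(t)^\top W_1(t)Q(t)y-\mathrm{tr}\{Q(t)^\top W_1(t)Q(t)\Sigma(t)\}=0\quad\text{at } t=\widehat\psi_1,$$ except on an event $F_m$ with $E[(1+\widehat\psi_1^2)\mathbf 1_{F_m}]=O(m^{-3/2})$. **Claim.** Write $W_1=W_1(\psi_1)$ and let $W_{1(1)}$ be the entrywise derivative of $W_1(t)$ at $t=\psi_1$. For all large $m$, $\widehat\psi_1$ has a finite second moment, and as $m\to\infty$, without assuming $K_e=K_v=0$, $$\mathrm{Var}(\widehat\psi_1)=\frac{2\,\mathrm{tr}(W_1\Sigma W_1\Sigma)}{\{\mathrm{tr}(W_1)\}^2}+\frac{K_e\,\mathrm{tr}(W_1^2D^2)+\psi_1^2K_v\,\mathrm{tr}(W_1^2)}{\{\mathrm{tr}(W_1)\}^2}+O(m^{-3/2})$$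 and $$\begin{aligned}E(\widehat\psi_1-\psi_1)={}&2\,\frac{\mathrm{tr}(W_1)\,\mathrm{tr}(W_{1(1)}\Sigma W_1\Sigma)-\mathrm{tr}(W_{1(1)})\,\mathrm{tr}(W_1\Sigma W_1\Sigma)}{\{\mathrm{tr}(W_1)\}^3}\\&+\frac{K_e\,\mathrm{tr}(W_{1(1)}W_1D^2)+\psi_1^2K_v\,\mathrm{tr}(W_{1(1)}W_1)}{\{\mathrm{tr}(W_1)\}^2}\\&-\frac{\mathrm{tr}(W_{1(1)})\{K_e\,\mathrm{tr}(W_1^2D^2)+\psi_1^2K_v\,\mathrm{tr}(W_1^2)\}}{\{\mathrm{tr}(W_1)\}^3}+O(m^{-3/2}).\end{aligned}$$ -/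

import Mathlib

open MeasureTheory ProbabilityTheory Filter Asymptotics Matrix Set
open scoped ENNReal

namespace FayHerriot

noncomputable section

/-- The covariance matrix `Σ(t) = t I + D` with `D = diag(D₁, …, D_m)`. -/
def sigma {m : ℕ} (D : Fin m → ℝ) (t : ℝ) : Matrix (Fin m) (Fin m) ℝ :=
  t • (1 : Matrix (Fin m) (Fin m) ℝ) + Matrix.diagonal D

/-- The matrix `Q = I - X L`; the residual `y - X β̂` with `β̂ = L y` is `Q y`. -/
def residualMatrix {m p : ℕ} (X : Matrix (Fin m) (Fin p) ℝ) (L : Matrix (Fin p) (Fin m) ℝ) :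
    Matrix (Fin m) (Fin m) ℝ :=
  1 - X * L

/-- The matrix `Q(t)ᵀ W(t) Q(t)`. -/
def quadMatrix {m p : ℕ} (X : Matrix (Fin m) (Fin p) ℝ) (L : ℝ → Matrix (Fin p) (Fin m) ℝ)
    (W : ℝ → Matrix (Fin m) (Fin m) ℝ) (t : ℝ) : Matrix (Fin m) (Fin m) ℝ :=
  (residualMatrix X (L t))ᵀ * W t * residualMatrix X (L t)

/-- The left-hand side `yᵀ Qᵀ W Q y - tr (Qᵀ W Q Σ)` of the estimating equation, at `t`. -/
def estimatingFunction {m p : ℕ} (D : Fin m → ℝ) (X : Matrix (Fin m) (Fin p) ℝ)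
    (L : ℝ → Matrix (Fin p) (Fin m) ℝ) (W : ℝ → Matrix (Fin m) (Fin m) ℝ)
    (y : Fin m → ℝ) (t : ℝ) : ℝ :=
  y ⬝ᵥ (quadMatrix X L W t *ᵥ y) - (quadMatrix X L W t * sigma D t).trace

/-- The observation `y = X β + v + ε`. -/
def observation {Ω : Type*} {m p : ℕ} (X : Matrix (Fin m) (Fin p) ℝ) (β : Fin p → ℝ)
    (v ε : Fin m → Ω → ℝ) (ω : Ω) : Fin m → ℝ :=
  X *ᵥ β + (fun i => v i ω) + (fun i => ε i ω)

/-- The entrywise derivative of a matrix-valued function. -/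
def entryDeriv {m : ℕ} (W : ℝ → Matrix (Fin m) (Fin m) ℝ) (t : ℝ) :
    Matrix (Fin m) (Fin m) ℝ :=
  Matrix.of fun i j => deriv (fun s => W s i j) t

/-- The random effects `v` and the sampling errors `ε` of the Fay–Herriot model: centred,
independent, with `Var v i = ψ` and `Var (ε i) = D i`, with kurtoses `Kv` and `Ke` of the
standardized variables, and with finite sixth moments that are at most `M`. -/
structure IsErrorModel {Ω : Type*} [MeasurableSpace Ω] (μ : Measure Ω) {m : ℕ}
    (D : Fin m → ℝ) (ψ Ke Kv M : ℝ) (v ε : Fin m → Ω → ℝ) : Prop where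
  D_pos : ∀ i, 0 < D i
  measurable_v : ∀ i, Measurable (v i)
  measurable_ε : ∀ i, Measurable (ε i)
  indep : iIndepFun (Sum.elim v ε) μ
  memLp_v : ∀ i, MemLp (v i) 6 μ
  memLp_ε : ∀ i, MemLp (ε i) 6 μ
  sixth_v : ∀ i, ∫ ω, (v i ω) ^ 6 ∂μ ≤ M
  sixth_ε : ∀ i, ∫ ω, (ε i ω) ^ 6 ∂μ ≤ M
  mean_v : ∀ i, ∫ ω, v i ω ∂μ = 0
  mean_ε : ∀ i, ∫ ω, ε i ω ∂μ = 0
  var_v : ∀ i, ∫ ω, (v i ω) ^ 2 ∂μ = ψ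
  var_ε : ∀ i, ∫ ω, (ε i ω) ^ 2 ∂μ = D i
  fourth_v : ∀ i, ∫ ω, (v i ω / √ψ) ^ 4 ∂μ = Kv + 3
  fourth_ε : ∀ i, ∫ ω, (ε i ω / √(D i)) ^ 4 ∂μ = Ke + 3

/-- `f` is three times continuously differentiable on `(a, b)`, and `f, f', f'', f'''` are
bounded there by `B` in absolute value. -/
def BoundedC3 (a b B : ℝ) (f : ℝ → ℝ) : Prop :=
  ContDiffOn ℝ 3 f (Ioo a b) ∧ ∀ k ≤ 3, ∀ t ∈ Ioo a b, |iteratedDeriv k f t| ≤ B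

/-- The asymptotic variance formula. -/
def asymptoticVariance {m : ℕ} (D : Fin m → ℝ) (ψ Ke Kv : ℝ)
    (W : ℝ → Matrix (Fin m) (Fin m) ℝ) : ℝ :=
  2 * (W ψ * sigma D ψ * W ψ * sigma D ψ).trace / (W ψ).trace ^ 2
    + (Ke * (W ψ ^ 2 * Matrix.diagonal D ^ 2).trace + ψ ^ 2 * Kv * (W ψ ^ 2).trace)
      / (W ψ).trace ^ 2

/-- The second-order bias formula. -/
def secondOrderBias {m : ℕ} (D : Fin m → ℝ) (ψ Ke Kv : ℝ)
    (W : ℝ → Matrix (Fin m) (Fin m) ℝ) : ℝ :=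
  2 * ((W ψ).trace * (entryDeriv W ψ * sigma D ψ * W ψ * sigma D ψ).trace
        - (entryDeriv W ψ).trace * (W ψ * sigma D ψ * W ψ * sigma D ψ).trace)
      / (W ψ).trace ^ 3
    + (Ke * (entryDeriv W ψ * W ψ * Matrix.diagonal D ^ 2).trace
        + ψ ^ 2 * Kv * (entryDeriv W ψ * W ψ).trace) / (W ψ).trace ^ 2
    - (entryDeriv W ψ).trace
        * (Ke * (W ψ ^ 2 * Matrix.diagonal D ^ 2).trace + ψ ^ 2 * Kv * (W ψ ^ 2).trace)
      / (W ψ).trace ^ 3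

end

end FayHerriot

namespace FayHerriot

/-! ### Real inequalities -/

/-! Put `u = v + ε` and `A(t) = Q(t)ᵀ W(t) Q(t)`. Since `Q X = 0`, the regression part drops out,
and since `Σ(t) = Σ(ψ) + (t - ψ) I`, the estimating equation at `t` reads `g(t) = (t - ψ) T(t)`,
where `T = tr A` and `g(t) = uᵀ A(t) u - tr (A(t) Σ(ψ))` is a centred quadratic form. Its
`t`-derivatives are centred quadratic forms too, with the matrices `A'`, `A''`, `A'''`.

The trace has order `m` on all of `(a, b)` and `g` has order `√m`, so every root satisfies `|φ - ψ|
≤ |g(φ)| / |T(φ)|`, of order `m^(-1/2)`; no separate consistency argument is needed. With `G, G₁, T,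
T₁` the values of `g, g', T, T'` at `ψ`, a Taylor expansion (`root_expansion`) gives `φ - ψ = G/T +
G G₁/T² - G² T₁/T³` up to `O(s³)`, where `s` bounds `|g|, |g'|, |g''|` on `(a, b)` divided by `m`.
The first term has mean zero, the next two give the bias, and `G²/T²` gives the variance because the
squared bias is `O(m^(-2))`.

Three estimates carry the proof. (1) `E|g(t)|³ = O(m^(3/2))`, also for the first three derivatives
(`integral_abs_quadOn_pow_three_le`). Adding the indices one at a time makes the form a martingale;
its increments have bounded third moments, which is what the sixth moments of `u` provide. (2) The
supremum over `t` costs one derivative (`exists_dominating_of_hasDerivAt`), so `g''` calls for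
`A'''`. Hence `E s³ = O(m^(-3/2))`. (3) `A` is `diag w + P` with `P` of entrywise order `1/m`. The
part from `P` has bounded variance, so it changes a covariance of order `m` by `O(√m)` only
(`abs_integral_quadOn_mul_sub_le`). The diagonal part is computed exactly, from `E(uᵢ² - ψ - Dᵢ)² =
2(ψ + Dᵢ)² + Ke Dᵢ² + Kv ψ²`.

On the exceptional event the remainders are at most a constant times `1 + φ² + s³`, which is
absorbed by the assumption on that event. -/

theorem abs_add_pow_three_le (x z : ℝ) :
    |x + z| ^ 3 ≤ |x| ^ 3 + 3 * (x * |x|) * z + 3 * |x| * z ^ 2 + |z| ^ 3 := by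
  -- Both sides are unchanged under `(x, z) ↦ (-x, -z)`, so `x ≥ 0` may be assumed. The term linear
  -- in `z` keeps its sign because it will integrate to zero.
  have key : ∀ x z : ℝ, 0 ≤ x →
      |x + z| ^ 3 ≤ |x| ^ 3 + 3 * (x * |x|) * z + 3 * |x| * z ^ 2 + |z| ^ 3 := by
    intro x z hx
    rw [abs_of_nonneg hx]
    rcases le_total 0 (x + z) with h | h
    · rw [abs_of_nonneg h]
      have : z ^ 3 ≤ |z| ^ 3 := by
        rw [← abs_pow]; exact le_abs_self _
      nlinarith
    · have hz : z ≤ 0 := by linarith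
      rw [abs_of_nonpos h, abs_of_nonpos hz]
      have : 0 ≤ x * (x ^ 2 + 3 * x * z + 3 * z ^ 2) :=
        mul_nonneg hx (by nlinarith [sq_nonneg (2 * x + 3 * z), sq_nonneg z])
      nlinarith
  rcases le_total 0 x with h | h
  · exact key x z h
  · have := key (-x) (-z) (by linarith)
    rw [← neg_add, abs_neg, abs_neg, abs_neg] at this
    linarith [this]

/-- Young's inequality with a free weight: for `x = r w` the difference of the two sides is `r (w -
y)² (w + 2y)`. The choice `r = √n` later makes the loss in `x ^ 3` a factor `1 + 1/n` per step. -/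
theorem three_mul_mul_sq_le {x y r : ℝ} (hx : 0 ≤ x) (hy : 0 ≤ y) (hr : 0 < r) :
    3 * x * y ^ 2 ≤ x ^ 3 / r ^ 2 + 2 * r * y ^ 3 := by
  obtain ⟨w, rfl⟩ : ∃ w, x = r * w := ⟨x / r, by field_simp⟩
  have hw : 0 ≤ w := nonneg_of_mul_nonneg_right hx hr
  have h1 : (r * w) ^ 3 / r ^ 2 = r * w ^ 3 := by field_simp
  have h2 : 0 ≤ r * ((w - y) ^ 2 * (w + 2 * y)) := by positivity
  rw [h1]
  nlinarith

theorem add_pow_three_le {x y : ℝ} (hx : 0 ≤ x) (hy : 0 ≤ y) :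
    (x + y) ^ 3 ≤ 4 * (x ^ 3 + y ^ 3) := by
  nlinarith [mul_nonneg (add_nonneg hx hy) (sq_nonneg (x - y))]

/-- The mean value inequality is applied twice, to `f₁` and then to `s ↦ f s - s * f₁ x`. This loses
the factor `1/2` of Taylor's theorem, which is irrelevant here. -/
theorem abs_sub_sub_mul_le {f f₁ f₂ : ℝ → ℝ} {a b C x t : ℝ}
    (h0 : ∀ s ∈ Ioo a b, HasDerivAt f (f₁ s) s) (h1 : ∀ s ∈ Ioo a b, HasDerivAt f₁ (f₂ s) s)
    (h2 : ∀ s ∈ Ioo a b, |f₂ s| ≤ C) (hx : x ∈ Ioo a b) (ht : t ∈ Ioo a b) :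
    |f t - f x - (t - x) * f₁ x| ≤ C * (t - x) ^ 2 := by
  have hsub : uIcc x t ⊆ Ioo a b := ordConnected_Ioo.uIcc_subset hx ht
  have hC : 0 ≤ C := (abs_nonneg _).trans (h2 x hx)
  have hb : ∀ s ∈ uIcc x t, ‖f₁ s - f₁ x‖ ≤ C * |t - x| := by
    intro s hs
    have := (convex_Ioo a b).norm_image_sub_le_of_norm_hasDerivWithin_le (f := f₁) (f' := f₂)
      (C := C) (fun y hy => (h1 y hy).hasDerivWithinAt) h2 hx (hsub hs)
    refine this.trans (mul_le_mul_of_nonneg_left ?_ hC)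
    rw [Real.norm_eq_abs]
    exact abs_sub_left_of_mem_uIcc hs
  have := (convex_uIcc x t).norm_image_sub_le_of_norm_hasDerivWithin_le
    (f := fun s => f s - s * f₁ x) (f' := fun s => f₁ s - f₁ x) (C := C * |t - x|)
    (fun y hy => by
      have : HasDerivAt (fun s => f s - s * f₁ x) (f₁ y - 1 * f₁ x) y :=
        (h0 y (hsub hy)).sub ((hasDerivAt_id y).mul_const (f₁ x))
      rw [one_mul] at this
      exact this.hasDerivWithinAt) hb left_mem_uIcc right_mem_uIcc
  rw [Real.norm_eq_abs, Real.norm_eq_abs, mul_assoc, abs_mul_abs_self] at this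
  calc |f t - f x - (t - x) * f₁ x| = |f t - t * f₁ x - (f x - x * f₁ x)| := by congr 1; ring
    _ ≤ C * ((t - x) * (t - x)) := this
    _ = _ := by ring

theorem abs_sub_le_mul {f f₁ : ℝ → ℝ} {a b C x t : ℝ}
    (h0 : ∀ s ∈ Ioo a b, HasDerivAt f (f₁ s) s)
    (h1 : ∀ s ∈ Ioo a b, |f₁ s| ≤ C) (hx : x ∈ Ioo a b) (ht : t ∈ Ioo a b) :
    |f t - f x| ≤ C * |t - x| :=
  (convex_Ioo a b).norm_image_sub_le_of_norm_hasDerivWithin_le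
    (fun y hy => (h0 y hy).hasDerivWithinAt) h1 hx ht

/-- Second-order expansion of a root `δ` of `δ T(δ) = G(δ)`, for small `G`. -/
theorem root_expansion {c K : ℝ} (hc : 0 < c) (hK : 0 ≤ K) : ∃ C : ℝ, 0 ≤ C ∧
    ∀ δ s Tδ T T₁ Gδ G G₁ : ℝ, 0 ≤ s → δ * Tδ = Gδ → c ≤ |Tδ| → c ≤ |T| → |T₁| ≤ K →
      |Gδ| ≤ s → |G| ≤ s → |G₁| ≤ s → |Tδ - T| ≤ K * |δ| → |Gδ - G| ≤ s * |δ| →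
      |Tδ - T - δ * T₁| ≤ K * δ ^ 2 → |Gδ - G - δ * G₁| ≤ s * δ ^ 2 →
      |δ - (G / T + (G * G₁ / T ^ 2 - G ^ 2 * T₁ / T ^ 3))| ≤ C * s ^ 3 ∧
      |δ ^ 2 - G ^ 2 / T ^ 2| ≤ C * s ^ 3 := by
  set A := 1 / c ^ 2 + K / c ^ 3 with hA
  have hA0 : 0 ≤ A := by positivity
  -- `A` is the constant in `|δ - G/T| ≤ A s²`. The last two summands serve the first claim, `2 * A
  -- / c` serves the second, and the leading `A` is slack.
  refine ⟨A + 2 * A / c + (A + 2 * A * K / c) / c + A / c, by positivity, ?_⟩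
  intro δ s Tδ T T₁ Gδ G G₁ hs hroot hTδ hT hT₁ hGδ hG hG₁ hdT hdG htT htG
  have hT0 : T ≠ 0 := by intro h; rw [h, abs_zero] at hT; linarith
  have hδ : |δ| ≤ s / c := by
    rw [le_div_iff₀ hc]
    calc |δ| * c ≤ |δ| * |Tδ| := by gcongr
      _ = |Gδ| := by rw [← abs_mul, hroot]
      _ ≤ s := hGδ
  have hinv : |T|⁻¹ ≤ 1 / c := by rw [one_div]; exact inv_anti₀ hc hT
  have hGT : |G / T| ≤ s / c := by
    rw [abs_div]; exact div_le_div₀ hs hG hc hT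
  have hδ2 : δ ^ 2 ≤ (s / c) ^ 2 := by rw [← sq_abs]; gcongr
  have hδ3 : |δ| ^ 3 ≤ (s / c) ^ 3 := by gcongr
  have he2' : |δ * T - G| ≤ c * (A * s ^ 2) := by
    have : δ * T - G = (Gδ - G) - δ * (Tδ - T) := by rw [← hroot]; ring
    rw [this]
    calc |(Gδ - G) - δ * (Tδ - T)| ≤ |Gδ - G| + |δ| * |Tδ - T| := by
          rw [← abs_mul]; exact abs_sub _ _
      _ ≤ s * |δ| + |δ| * (K * |δ|) := by gcongr
      _ ≤ s * (s / c) + (s / c) * (K * (s / c)) := by gcongr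
      _ = c * (A * s ^ 2) := by rw [hA]; field_simp
  have he2 : |δ - G / T| ≤ A * s ^ 2 := by
    have : δ - G / T = (δ * T - G) * T⁻¹ := by field_simp
    rw [this, abs_mul, abs_inv]
    calc |δ * T - G| * |T|⁻¹ ≤ c * (A * s ^ 2) * (1 / c) := by gcongr
      _ = A * s ^ 2 := by field_simp
  have hsq : |δ ^ 2 - G ^ 2 / T ^ 2| ≤ 2 * A / c * s ^ 3 := by
    have : δ ^ 2 - G ^ 2 / T ^ 2 = (δ - G / T) * (δ + G / T) := by field_simp; ring
    rw [this, abs_mul]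
    calc |δ - G / T| * |δ + G / T| ≤ A * s ^ 2 * (s / c + s / c) := by
          gcongr; exact (abs_add_le _ _).trans (add_le_add hδ hGT)
      _ = _ := by ring
  have he1 : |δ * T - G - δ * G₁ + δ ^ 2 * T₁| ≤ A * s ^ 3 := by
    have : δ * T - G - δ * G₁ + δ ^ 2 * T₁
        = (Gδ - G - δ * G₁) - δ * (Tδ - T - δ * T₁) := by rw [← hroot]; ring
    rw [this]
    calc _ ≤ |Gδ - G - δ * G₁| + |δ| * |Tδ - T - δ * T₁| := by
          rw [← abs_mul]; exact abs_sub _ _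
      _ ≤ s * δ ^ 2 + |δ| * (K * δ ^ 2) := by gcongr
      _ = s * δ ^ 2 + K * |δ| ^ 3 := by rw [← sq_abs]; ring
      _ ≤ s * (s / c) ^ 2 + K * (s / c) ^ 3 := by gcongr
      _ = A * s ^ 3 := by rw [hA]; field_simp
  have hs3 : 0 ≤ s ^ 3 := by positivity
  refine ⟨?_, hsq.trans (mul_le_mul_of_nonneg_right ?_ hs3)⟩
  -- The equation gives `δ T = G + δ G₁ - δ² T₁ + O(s³)`. Replacing `δ` by `G/T` and `δ²` by `G²/T²`
  -- on the right costs `O(s³)` each, since `G₁ = O(s)` and `T₁ = O(1)`.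
  · have : δ - (G / T + (G * G₁ / T ^ 2 - G ^ 2 * T₁ / T ^ 3))
        = ((δ * T - G - δ * G₁ + δ ^ 2 * T₁) + (δ - G / T) * G₁
            - (δ ^ 2 - G ^ 2 / T ^ 2) * T₁) * T⁻¹ := by field_simp; ring
    rw [this, abs_mul, abs_inv]
    calc _ ≤ (A * s ^ 3 + A * s ^ 2 * s + 2 * A / c * s ^ 3 * K) * (1 / c) := by
          gcongr
          refine (abs_sub _ _).trans (add_le_add ((abs_add_le _ _).trans (add_le_add he1 ?_)) ?_)
          · rw [abs_mul]; gcongr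
          · rw [abs_mul]; gcongr
      _ = ((A + 2 * A * K / c) / c + A / c) * s ^ 3 := by field_simp; ring
      _ ≤ _ := by
          apply mul_le_mul_of_nonneg_right _ hs3
          have : 0 ≤ A + 2 * A / c := by positivity
          linarith
  · have : 0 ≤ A + (A + 2 * A * K / c) / c + A / c := by positivity
    linarith

theorem abs_inv_sub_inv_le {c e x y : ℝ} (hc : 0 < c) (hx : c ≤ |x|) (hy : c ≤ |y|)
    (h : |x - y| ≤ e) : |x⁻¹ - y⁻¹| ≤ e / c ^ 2 := by
  have hx0 : x ≠ 0 := by intro h; rw [h, abs_zero] at hx; linarith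
  have hy0 : y ≠ 0 := by intro h; rw [h, abs_zero] at hy; linarith
  rw [inv_sub_inv hx0 hy0, abs_div, abs_mul, abs_sub_comm, pow_two]
  exact div_le_div₀ ((abs_nonneg _).trans h) h (by positivity) (by gcongr)

/-- The two leading terms depend in a Lipschitz way on their ingredients. -/
theorem leading_terms_stable {c K : ℝ} (hc : 0 < c) (hK : 0 ≤ K) : ∃ C : ℝ, 0 ≤ C ∧
    ∀ e x x₀ y y₀ T τ T₁ τ₁ : ℝ, c ≤ |T| → c ≤ |τ| → |x₀| ≤ K → |y₀| ≤ K →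
      |T₁| ≤ K → |τ₁| ≤ K → |x - x₀| ≤ e → |y - y₀| ≤ e → |T - τ| ≤ e → |T₁ - τ₁| ≤ e →
      |y / T ^ 2 - y₀ / τ ^ 2| ≤ C * e ∧
      |(x / T ^ 2 - y * T₁ / T ^ 3) - (x₀ / τ ^ 2 - y₀ * τ₁ / τ ^ 3)| ≤ C * e := by
  set q := 1 / c with hq
  have hq0 : 0 ≤ q := by positivity
  set C₁ := q ^ 2 + K * (q ^ 2 * (2 * q)) with hC₁
  set C₂ := q ^ 3 * K + K * (q ^ 3) + K * K * (q ^ 2 * (3 * q ^ 2)) with hC₂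
  refine ⟨C₁ + (C₁ + C₂), by positivity, ?_⟩
  intro e x x₀ y y₀ T τ T₁ τ₁ hT hτ hx hy hT₁ hτ₁ hxx hyy hTT hTT₁
  have he : 0 ≤ e := (abs_nonneg _).trans hxx
  have hi : |T⁻¹| ≤ q := by rw [abs_inv, hq, one_div]; exact inv_anti₀ hc hT
  have hj : |τ⁻¹| ≤ q := by rw [abs_inv, hq, one_div]; exact inv_anti₀ hc hτ
  have hij : |T⁻¹ - τ⁻¹| ≤ q ^ 2 * e := by
    refine (abs_inv_sub_inv_le hc hT hτ hTT).trans (le_of_eq ?_)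
    rw [hq]; field_simp
  have hC1 : 0 ≤ C₁ := by positivity
  have hC2 : 0 ≤ C₂ := by positivity
  simp only [div_eq_mul_inv, ← inv_pow]
  generalize T⁻¹ = i at *
  generalize τ⁻¹ = j at *
  have hsum : |i + j| ≤ 2 * q := (abs_add_le _ _).trans (by linarith)
  have hquad : ∀ z z₀ : ℝ, |z₀| ≤ K → |z - z₀| ≤ e → |z * i ^ 2 - z₀ * j ^ 2| ≤ C₁ * e := by
    intro z z₀ hz hzz
    have : z * i ^ 2 - z₀ * j ^ 2 = (z - z₀) * i ^ 2 + z₀ * ((i - j) * (i + j)) := by ring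
    rw [this]
    calc _ ≤ |z - z₀| * |i| ^ 2 + |z₀| * (|i - j| * |i + j|) := by
          refine (abs_add_le _ _).trans (le_of_eq ?_)
          simp only [abs_mul, abs_pow]
      _ ≤ e * q ^ 2 + K * (q ^ 2 * e * (2 * q)) := by gcongr
      _ = C₁ * e := by rw [hC₁]; ring
  have hcub : |y * T₁ * i ^ 3 - y₀ * τ₁ * j ^ 3| ≤ C₂ * e := by
    have : y * T₁ * i ^ 3 - y₀ * τ₁ * j ^ 3 = (y - y₀) * (T₁ * i ^ 3)
        + y₀ * ((T₁ - τ₁) * i ^ 3) + y₀ * (τ₁ * ((i - j) * (i ^ 2 + i * j + j ^ 2))) := by ring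
    rw [this]
    calc _ ≤ |y - y₀| * (|T₁| * |i| ^ 3) + |y₀| * (|T₁ - τ₁| * |i| ^ 3)
            + |y₀| * (|τ₁| * (|i - j| * |i ^ 2 + i * j + j ^ 2|)) := by
          refine (abs_add_le _ _).trans (add_le_add ((abs_add_le _ _).trans (le_of_eq ?_))
            (le_of_eq ?_)) <;> simp only [abs_mul, abs_pow]
      _ ≤ e * (K * q ^ 3) + K * (e * q ^ 3) + K * (K * (q ^ 2 * e * (3 * q ^ 2))) := by
          gcongr
          calc |i ^ 2 + i * j + j ^ 2| ≤ |i| ^ 2 + |i| * |j| + |j| ^ 2 := by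
                refine (abs_add_le _ _).trans (add_le_add ((abs_add_le _ _).trans ?_) ?_)
                · simp only [abs_mul, abs_pow]; rfl
                · simp only [abs_pow]; rfl
            _ ≤ q ^ 2 + q * q + q ^ 2 := by gcongr
            _ = 3 * q ^ 2 := by ring
      _ = C₂ * e := by rw [hC₂]; ring
  constructor
  · refine (hquad y y₀ hy hyy).trans (mul_le_mul_of_nonneg_right (by linarith) he)
  · have : x * i ^ 2 - y * T₁ * i ^ 3 - (x₀ * j ^ 2 - y₀ * τ₁ * j ^ 3)
        = (x * i ^ 2 - x₀ * j ^ 2) - (y * T₁ * i ^ 3 - y₀ * τ₁ * j ^ 3) := by ring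
    rw [this]
    refine (abs_sub _ _).trans ((add_le_add (hquad x x₀ hx hxx) hcub).trans ?_)
    rw [← add_mul]
    exact mul_le_mul_of_nonneg_right (by linarith) he

/-! ### Integrability of products -/

section Integrability

variable {Ω : Type*} [MeasurableSpace Ω] {μ : Measure Ω} {f g : Ω → ℝ}

theorem _root_.MeasureTheory.MemLp.integrable_abs_pow_three (hf : MemLp f 3 μ) :
    Integrable (fun ω => |f ω| ^ 3) μ := by
  have h : MemLp f ((3 : ℕ) : ℝ≥0∞) μ := by exact_mod_cast hf
  simpa using h.integrable_norm_pow (by norm_num)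

theorem integrable_pow_six (hf : MemLp f 6 μ) : Integrable (fun ω => f ω ^ 6) μ := by
  have h : MemLp f ((6 : ℕ) : ℝ≥0∞) μ := by exact_mod_cast hf
  have := h.integrable_norm_pow (by norm_num)
  refine this.congr (ae_of_all _ fun ω => ?_)
  simp only [Real.norm_eq_abs]
  exact (even_two_mul 3).pow_abs (f ω)

theorem abs_pow_le_one_add_pow_six (x : ℝ) {k : ℕ} (hk : k ≤ 6) : |x| ^ k ≤ 1 + x ^ 6 := by
  have h6 : x ^ 6 = |x| ^ 6 := ((even_two_mul 3).pow_abs x).symm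
  rw [h6]
  rcases le_total |x| 1 with h | h
  · have := pow_le_one₀ (n := k) (abs_nonneg x) h
    have : 0 ≤ |x| ^ 6 := by positivity
    linarith
  · have := pow_le_pow_right₀ h hk
    linarith

theorem memLp_three_mul (hf : MemLp f 6 μ) (hg : MemLp g 6 μ) :
    MemLp (fun ω => f ω * g ω) 3 μ := by
  have : ENNReal.HolderTriple 6 6 3 := ⟨by
    rw [← two_mul, show (6 : ℝ≥0∞) = 2 * 3 by norm_num,
      ENNReal.mul_inv (Or.inl (by norm_num)) (Or.inl (by norm_num)), ← mul_assoc,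
      ENNReal.mul_inv_cancel (by norm_num) (by norm_num), one_mul]⟩
  exact hg.mul hf

theorem integrable_mul_abs_mul (hf : MemLp f 3 μ) (hg : MemLp g 3 μ) :
    Integrable (fun ω => f ω * |f ω| * g ω) μ := by
  refine Integrable.mono' (hf.integrable_abs_pow_three.add hg.integrable_abs_pow_three)
    ((hf.aestronglyMeasurable.mul hf.abs.aestronglyMeasurable).mul hg.aestronglyMeasurable)
    (ae_of_all _ fun ω => ?_)
  have h1 := abs_nonneg (f ω)
  have h2 := abs_nonneg (g ω)
  simp only [Real.norm_eq_abs, abs_mul, abs_abs, Pi.add_apply]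
  nlinarith [three_mul_mul_sq_le h2 h1 one_pos, pow_nonneg h1 3, pow_nonneg h2 3]

variable [IsProbabilityMeasure μ]

theorem integrable_pow_of_memLp_six (hf : MemLp f 6 μ) {k : ℕ} (hk : k ≤ 6) :
    Integrable (fun ω => f ω ^ k) μ := by
  refine Integrable.mono' ((integrable_const (1 : ℝ)).add (integrable_pow_six hf))
    (hf.aestronglyMeasurable.pow k) (ae_of_all _ fun ω => ?_)
  simpa using abs_pow_le_one_add_pow_six (f ω) hk

theorem integrable_mul_of_memLp_three (hf : MemLp f 3 μ) (hg : MemLp g 3 μ) :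
    Integrable (fun ω => f ω * g ω) μ :=
  (hf.mono_exponent (by norm_num : (2 : ℝ≥0∞) ≤ 3)).integrable_mul
    (hg.mono_exponent (by norm_num : (2 : ℝ≥0∞) ≤ 3))

theorem integrable_sq_of_memLp_three (hf : MemLp f 3 μ) : Integrable (fun ω => f ω ^ 2) μ := by
  simpa only [pow_two] using integrable_mul_of_memLp_three hf hf

theorem integrable_mul_abs_self (hf : MemLp f 3 μ) : Integrable (fun ω => f ω * |f ω|) μ :=
  integrable_mul_of_memLp_three hf hf.abs

end Integrability

/-! ### Centred quadratic forms in independent variables -/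

/-- Independent centred random variables with variances `s i` and sixth moments at most `M`. -/
structure IsCenteredFamily {Ω ι : Type*} [MeasurableSpace Ω] (μ : Measure Ω) (u : ι → Ω → ℝ)
    (s : ι → ℝ) (M : ℝ) : Prop where
  measurable : ∀ i, Measurable (u i)
  indep : ∀ (S : Finset ι) (k : ι), k ∉ S → IndepFun (fun ω (i : S) => u i ω) (u k) μ
  memLp : ∀ i, MemLp (u i) 6 μ
  sixth : ∀ i, ∫ ω, u i ω ^ 6 ∂μ ≤ M
  mean : ∀ i, ∫ ω, u i ω ∂μ = 0
  var : ∀ i, ∫ ω, u i ω ^ 2 ∂μ = s i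

/-- The centred quadratic form with matrix `a`, restricted to the indices in `S`. -/
def quadOn {ι : Type*} (s : ι → ℝ) (a : Matrix ι ι ℝ) (S : Finset ι) (x : ι → ℝ) : ℝ :=
  ∑ i ∈ S, ∑ j ∈ S, a i j * (x i * x j) - ∑ i ∈ S, a i i * s i

/-- The linear form that multiplies `x k` when the index `k` is added to `S`. -/
def crossForm {ι : Type*} (a : Matrix ι ι ℝ) (S : Finset ι) (k : ι) (x : ι → ℝ) : ℝ :=
  ∑ j ∈ S, (a k j + a j k) * x j

/-- The increment of `quadOn` when the index `k` is added to `S`. -/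
def quadIncrement {ι : Type*} (s : ι → ℝ) (a : Matrix ι ι ℝ) (S : Finset ι) (k : ι)
    (x : ι → ℝ) : ℝ :=
  a k k * (x k ^ 2 - s k) + x k * crossForm a S k x

section QuadOn

variable {ι : Type*} {s : ι → ℝ} {a : Matrix ι ι ℝ} {S : Finset ι} {k : ι}

theorem quadOn_insert [DecidableEq ι] (hk : k ∉ S) (x : ι → ℝ) :
    quadOn s a (insert k S) x = quadOn s a S x + quadIncrement s a S k x := by
  simp only [quadOn, quadIncrement, crossForm, Finset.sum_insert hk, Finset.sum_add_distrib,
    Finset.mul_sum, add_mul, mul_add]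
  have h1 : ∑ i ∈ S, x k * (a k i * x i) = ∑ i ∈ S, a k i * (x k * x i) :=
    Finset.sum_congr rfl fun _ _ => by ring
  have h2 : ∑ i ∈ S, x k * (a i k * x i) = ∑ i ∈ S, a i k * (x i * x k) :=
    Finset.sum_congr rfl fun _ _ => by ring
  rw [h1, h2]
  ring

theorem measurable_quadOn : Measurable (quadOn s a S) := by
  unfold quadOn
  fun_prop

theorem measurable_crossForm : Measurable (crossForm a S k) := by
  unfold crossForm
  fun_prop

theorem quadOn_congr {x y : ι → ℝ} (h : ∀ i ∈ S, x i = y i) : quadOn s a S x = quadOn s a S y := by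
  unfold quadOn
  congr 1
  exact Finset.sum_congr rfl fun i hi => Finset.sum_congr rfl fun j hj => by rw [h i hi, h j hj]

theorem crossForm_congr {x y : ι → ℝ} (h : ∀ i ∈ S, x i = y i) :
    crossForm a S k x = crossForm a S k y :=
  Finset.sum_congr rfl fun i hi => by rw [h i hi]

end QuadOn

namespace IsCenteredFamily

variable {Ω ι : Type*} [MeasurableSpace Ω] {μ : Measure Ω} {u : ι → Ω → ℝ} {s : ι → ℝ} {M : ℝ}

theorem memLp_mul (hu : IsCenteredFamily μ u s M) (i j : ι) :
    MemLp (fun ω => u i ω * u j ω) 3 μ :=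
  memLp_three_mul (hu.memLp i) (hu.memLp j)

theorem memLp_mul_crossForm (hu : IsCenteredFamily μ u s M) (a : Matrix ι ι ℝ) (S : Finset ι)
    (k : ι) : MemLp (fun ω => u k ω * crossForm a S k fun i => u i ω) 3 μ := by
  unfold crossForm
  simp only [Finset.mul_sum]
  refine memLp_finsetSum _ fun j _ => ?_
  have := (hu.memLp_mul k j).const_mul (a k j + a j k)
  refine this.ae_eq (ae_of_all _ fun ω => ?_)
  ring

/-- A function of the whole vector that only sees the coordinates in `S` factors through the
restriction to `S`: extend by zero off `S`. This lets `quadOn` and `crossForm` be used without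
subtypes. -/
theorem indepFun_of_notMem (hu : IsCenteredFamily μ u s M) {S : Finset ι} {k : ι} (hk : k ∉ S)
    {Ψ : (ι → ℝ) → ℝ} (hΨ : Measurable Ψ) (hΨS : ∀ x y, (∀ i ∈ S, x i = y i) → Ψ x = Ψ y)
    {θ : ℝ → ℝ} (hθ : Measurable θ) :
    IndepFun (fun ω => Ψ fun i => u i ω) (fun ω => θ (u k ω)) μ := by
  classical
  have h := hu.indep S k hk
  have hext : Measurable fun (x : S → ℝ) (i : ι) => if h : i ∈ S then x ⟨i, h⟩ else 0 := by
    refine measurable_pi_lambda _ fun i => ?_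
    by_cases hi : i ∈ S
    · simp only [hi, dif_pos]; fun_prop
    · simp only [hi, dif_neg, not_false_iff]; fun_prop
  have h2 := h.comp (hΨ.comp hext) hθ
  refine (IndepFun.congr h2 (ae_of_all _ fun ω => ?_) (ae_of_all _ fun ω => rfl))
  refine hΨS _ _ fun i hi => ?_
  simp [hi]

theorem indepFun_ne (hu : IsCenteredFamily μ u s M) {i j : ι} (hij : i ≠ j)
    {φ θ : ℝ → ℝ} (hφ : Measurable φ) (hθ : Measurable θ) :
    IndepFun (fun ω => φ (u i ω)) (fun ω => θ (u j ω)) μ :=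
  hu.indepFun_of_notMem (S := {i}) (by simpa using hij.symm) (Ψ := fun x => φ (x i))
    (hφ.comp (measurable_pi_apply i)) (fun x y h => by rw [h i (Finset.mem_singleton_self i)]) hθ

theorem integral_mul_of_ne (hu : IsCenteredFamily μ u s M) {i j : ι} (hij : i ≠ j) :
    ∫ ω, u i ω * u j ω ∂μ = 0 := by
  have h := hu.indepFun_ne hij measurable_id measurable_id
  have := h.integral_fun_mul_eq_mul_integral (hu.measurable i).aestronglyMeasurable
    (hu.measurable j).aestronglyMeasurable
  simp only [id] at this
  rw [this, hu.mean i, zero_mul]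

theorem nonneg_of_index (hu : IsCenteredFamily μ u s M) (i : ι) : 0 ≤ M :=
  (integral_nonneg fun ω => (even_two_mul 3).pow_nonneg (u i ω)).trans (hu.sixth i)

theorem var_nonneg (hu : IsCenteredFamily μ u s M) (i : ι) : 0 ≤ s i := by
  rw [← hu.var i]; positivity

/-- Orthogonal expansion of a product of two linear combinations. -/
theorem integral_sum_mul_sum {Z : ι → Ω → ℝ} (hint : ∀ i j, Integrable (fun ω => Z i ω * Z j ω) μ)
    (horth : ∀ i j, i ≠ j → ∫ ω, Z i ω * Z j ω ∂μ = 0) (S : Finset ι) (f g : ι → ℝ) :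
    ∫ ω, (∑ i ∈ S, f i * Z i ω) * (∑ j ∈ S, g j * Z j ω) ∂μ
      = ∑ i ∈ S, f i * g i * ∫ ω, Z i ω ^ 2 ∂μ := by
  have : ∀ ω, (∑ i ∈ S, f i * Z i ω) * (∑ j ∈ S, g j * Z j ω)
      = ∑ i ∈ S, ∑ j ∈ S, f i * g j * (Z i ω * Z j ω) := fun ω => by
    rw [Finset.sum_mul_sum]
    exact Finset.sum_congr rfl fun _ _ => Finset.sum_congr rfl fun _ _ => by ring
  simp only [this]
  rw [integral_finsetSum _ fun i _ => integrable_finsetSum _ fun j _ => (hint i j).const_mul _]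
  refine Finset.sum_congr rfl fun i hi => ?_
  rw [integral_finsetSum _ fun j _ => (hint i j).const_mul _]
  rw [Finset.sum_eq_single i]
  · rw [integral_const_mul]; simp only [pow_two]
  · intro j _ hj
    rw [integral_const_mul, horth i j hj.symm, mul_zero]
  · exact fun h => absurd hi h

/-- Independence is not needed. Since `k ∉ S`, only off-diagonal entries occur, so there are at most
`n` terms with coefficients at most `2K/n`. The power mean inequality and `|u_k u_j|³ ≤ u_k⁶ + u_j⁶`
give `(2K/n)³ n² · n · 2M = 16 K³ M`. -/
theorem integral_abs_mul_crossForm_pow_three_le [Fintype ι]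
    (hu : IsCenteredFamily μ u s M)
    {a : Matrix ι ι ℝ} {K : ℝ} (hK : 0 ≤ K) {S : Finset ι} {k : ι} (hk : k ∉ S)
    (ha : ∀ i j, i ≠ j → |a i j| ≤ K / Fintype.card ι) :
    ∫ ω, |u k ω * crossForm a S k fun i => u i ω| ^ 3 ∂μ ≤ 16 * K ^ 3 * M := by
  have hM := hu.nonneg_of_index k
  have hn : (0 : ℝ) < Fintype.card ι := by exact_mod_cast Fintype.card_pos_iff.2 ⟨k⟩
  set n : ℝ := ((Fintype.card ι : ℕ) : ℝ)
  have hSn : (S.card : ℝ) ≤ n := Nat.cast_le.2 S.card_le_univ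
  have hint : ∀ j, Integrable (fun ω => u k ω ^ 6 + u j ω ^ 6) μ := fun j =>
    (integrable_pow_six (hu.memLp k)).add (integrable_pow_six (hu.memLp j))
  have hpt : ∀ ω, |u k ω * crossForm a S k fun i => u i ω| ^ 3
      ≤ ((2 * K / n) ^ 3 * n ^ 2) * ∑ j ∈ S, (u k ω ^ 6 + u j ω ^ 6) := by
    intro ω
    have h1 : |u k ω * crossForm a S k fun i => u i ω|
        ≤ (2 * K / n) * ∑ j ∈ S, |u k ω * u j ω| := by
      rw [crossForm, Finset.mul_sum, Finset.mul_sum]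
      refine (Finset.abs_sum_le_sum_abs _ _).trans (Finset.sum_le_sum fun j hj => ?_)
      have hjk : j ≠ k := fun h => hk (h ▸ hj)
      have : u k ω * ((a k j + a j k) * u j ω) = (a k j + a j k) * (u k ω * u j ω) := by ring
      rw [this, abs_mul]
      refine mul_le_mul_of_nonneg_right ?_ (abs_nonneg _)
      refine (abs_add_le _ _).trans ((add_le_add (ha k j hjk.symm) (ha j k hjk)).trans
        (le_of_eq (by ring)))
    have h2 : (∑ j ∈ S, |u k ω * u j ω|) ^ 3 ≤ n ^ 2 * ∑ j ∈ S, |u k ω * u j ω| ^ 3 := by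
      have h := pow_sum_div_card_le_sum_pow (s := S) (f := fun j => |u k ω * u j ω|)
        (fun j _ => abs_nonneg _) 2
      rcases S.eq_empty_or_nonempty with rfl | hS
      · simp
      have hc : (0 : ℝ) < (S.card : ℝ) ^ 2 := by
        have : 0 < S.card := hS.card_pos
        positivity
      rw [div_le_iff₀ hc] at h
      refine h.trans ?_
      rw [mul_comm]
      gcongr
    have h3 : ∀ j, |u k ω * u j ω| ^ 3 ≤ u k ω ^ 6 + u j ω ^ 6 := fun j => by
      have e1 : u k ω ^ 6 = (|u k ω| ^ 3) ^ 2 := by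
        rw [← pow_mul, mul_comm, (even_two_mul 3).pow_abs]; norm_num
      have e2 : u j ω ^ 6 = (|u j ω| ^ 3) ^ 2 := by
        rw [← pow_mul, mul_comm, (even_two_mul 3).pow_abs]; norm_num
      rw [abs_mul, mul_pow, e1, e2]
      nlinarith [sq_nonneg (|u k ω| ^ 3 - |u j ω| ^ 3), sq_nonneg (|u k ω| ^ 3),
        sq_nonneg (|u j ω| ^ 3)]
    calc _ ≤ ((2 * K / n) * ∑ j ∈ S, |u k ω * u j ω|) ^ 3 := by gcongr
      _ = (2 * K / n) ^ 3 * (∑ j ∈ S, |u k ω * u j ω|) ^ 3 := by ring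
      _ ≤ (2 * K / n) ^ 3 * (n ^ 2 * ∑ j ∈ S, |u k ω * u j ω| ^ 3) := by gcongr
      _ ≤ (2 * K / n) ^ 3 * (n ^ 2 * ∑ j ∈ S, (u k ω ^ 6 + u j ω ^ 6)) := by
          gcongr with j _; exact h3 j
      _ = _ := by ring
  calc _ ≤ ∫ ω, ((2 * K / n) ^ 3 * n ^ 2) * ∑ j ∈ S, (u k ω ^ 6 + u j ω ^ 6) ∂μ :=
        integral_mono (hu.memLp_mul_crossForm a S k).integrable_abs_pow_three
          ((integrable_finsetSum _ fun j _ => hint j).const_mul _) hpt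
    _ = ((2 * K / n) ^ 3 * n ^ 2) * ∑ j ∈ S, (∫ ω, u k ω ^ 6 ∂μ + ∫ ω, u j ω ^ 6 ∂μ) := by
        rw [integral_const_mul, integral_finsetSum _ fun j _ => hint j]
        congr 1
        exact Finset.sum_congr rfl fun j _ => integral_add (integrable_pow_six (hu.memLp k))
          (integrable_pow_six (hu.memLp j))
    _ ≤ ((2 * K / n) ^ 3 * n ^ 2) * ∑ j ∈ S, (M + M) := by
        gcongr with j _
        · exact hu.sixth k
        · exact hu.sixth j
    _ = ((2 * K / n) ^ 3 * n ^ 2) * (S.card * (M + M)) := by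
        rw [Finset.sum_const, nsmul_eq_mul]
    _ ≤ ((2 * K / n) ^ 3 * n ^ 2) * (n * (M + M)) := by gcongr
    _ = 16 * K ^ 3 * M := by field_simp; ring

variable [IsProbabilityMeasure μ]

theorem integral_abs_pow_le (hu : IsCenteredFamily μ u s M) (i : ι) {k : ℕ} (hk : k ≤ 6) :
    ∫ ω, |u i ω| ^ k ∂μ ≤ 1 + M := by
  have hint := integrable_pow_six (hu.memLp i)
  calc ∫ ω, |u i ω| ^ k ∂μ ≤ ∫ ω, (1 + u i ω ^ 6) ∂μ := by
        refine integral_mono ?_ ((integrable_const _).add hint)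
          fun ω => abs_pow_le_one_add_pow_six _ hk
        simpa only [abs_pow] using (integrable_pow_of_memLp_six (hu.memLp i) hk).abs
    _ = 1 + ∫ ω, u i ω ^ 6 ∂μ := by
        rw [integral_add (integrable_const _) hint]; simp
    _ ≤ 1 + M := by linarith [hu.sixth i]

theorem var_le (hu : IsCenteredFamily μ u s M) (i : ι) : s i ≤ 1 + M := by
  rw [← hu.var i]
  simpa only [sq_abs] using hu.integral_abs_pow_le i (k := 2) (by norm_num)

theorem memLp_three (hu : IsCenteredFamily μ u s M) (i : ι) : MemLp (u i) 3 μ :=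
  (hu.memLp i).mono_exponent (by norm_num)

theorem memLp_sq_sub (hu : IsCenteredFamily μ u s M) (i : ι) :
    MemLp (fun ω => u i ω ^ 2 - s i) 3 μ := by
  simp only [pow_two]
  exact (hu.memLp_mul i i).sub (memLp_const _)

theorem integral_sq_sub (hu : IsCenteredFamily μ u s M) (i : ι) :
    ∫ ω, (u i ω ^ 2 - s i) ∂μ = 0 := by
  rw [integral_sub (integrable_pow_of_memLp_six (hu.memLp i) (by norm_num))
    (integrable_const _), hu.var i]
  simp

theorem memLp_crossForm (hu : IsCenteredFamily μ u s M) (a : Matrix ι ι ℝ) (S : Finset ι) (k : ι) :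
    MemLp (fun ω => crossForm a S k fun i => u i ω) 3 μ := by
  unfold crossForm
  exact memLp_finsetSum _ fun j _ => (hu.memLp_three j).const_mul _

theorem memLp_quadOn (hu : IsCenteredFamily μ u s M) (a : Matrix ι ι ℝ) (S : Finset ι) :
    MemLp (fun ω => quadOn s a S fun i => u i ω) 3 μ := by
  unfold quadOn
  exact (memLp_finsetSum _ fun i _ => memLp_finsetSum _ fun j _ =>
    (hu.memLp_mul i j).const_mul _).sub (memLp_const _)

theorem memLp_quadIncrement (hu : IsCenteredFamily μ u s M) (a : Matrix ι ι ℝ) (S : Finset ι)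
    (k : ι) : MemLp (fun ω => quadIncrement s a S k fun i => u i ω) 3 μ :=
  ((hu.memLp_sq_sub k).const_mul _).add (hu.memLp_mul_crossForm a S k)

/-- An increment is orthogonal to every function of the previous variables. -/
theorem integral_mul_quadIncrement (hu : IsCenteredFamily μ u s M) (a : Matrix ι ι ℝ)
    {S : Finset ι} {k : ι} (hk : k ∉ S) {Ψ : (ι → ℝ) → ℝ} (hΨ : Measurable Ψ)
    (hΨS : ∀ x y, (∀ i ∈ S, x i = y i) → Ψ x = Ψ y)
    (hint : Integrable (fun ω => Ψ fun i => u i ω) μ)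
    (hint' : Integrable (fun ω => (Ψ fun i => u i ω) * crossForm a S k fun i => u i ω) μ) :
    ∫ ω, (Ψ fun i => u i ω) * quadIncrement s a S k (fun i => u i ω) ∂μ = 0 := by
  have hind₁ := hu.indepFun_of_notMem hk hΨ hΨS (θ := fun x => x ^ 2 - s k) (by fun_prop)
  have hind₂ := hu.indepFun_of_notMem hk (Ψ := fun x => Ψ x * crossForm a S k x)
    (hΨ.mul measurable_crossForm)
    (fun x y h => by rw [hΨS x y h, crossForm_congr h]) (θ := id) measurable_id
  have hi₁ := (hu.memLp_sq_sub k).integrable (by norm_num)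
  have hi₂ := (hu.memLp k).integrable (by norm_num)
  have e₁ := hind₁.integral_fun_mul_eq_mul_integral hint.aestronglyMeasurable
    hi₁.aestronglyMeasurable
  have e₂ := hind₂.integral_fun_mul_eq_mul_integral hint'.aestronglyMeasurable
    hi₂.aestronglyMeasurable
  simp only [id] at e₂
  rw [hu.integral_sq_sub k, mul_zero] at e₁
  rw [hu.mean k, mul_zero] at e₂
  have i₁ : Integrable (fun ω => a k k * ((Ψ fun i => u i ω) * (u k ω ^ 2 - s k))) μ :=
    (hind₁.integrable_mul hint hi₁).const_mul (a k k)
  have i₂ : Integrable (fun ω => (Ψ fun i => u i ω) * (crossForm a S k fun i => u i ω) * u k ω) μ :=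
    hind₂.integrable_mul hint' hi₂
  calc _ = ∫ ω, (a k k * ((Ψ fun i => u i ω) * (u k ω ^ 2 - s k))
        + (Ψ fun i => u i ω) * (crossForm a S k fun i => u i ω) * u k ω) ∂μ := by
        refine integral_congr_ae (ae_of_all _ fun ω => ?_)
        simp only [quadIncrement]; ring
    _ = 0 := by
        rw [integral_add i₁ i₂, integral_const_mul, e₁, e₂]; simp

theorem integral_sq_sub_mul_of_ne (hu : IsCenteredFamily μ u s M) {i j : ι} (hij : i ≠ j) :
    ∫ ω, (u i ω ^ 2 - s i) * (u j ω ^ 2 - s j) ∂μ = 0 := by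
  have h := hu.indepFun_ne hij (φ := fun x => x ^ 2 - s i) (θ := fun x => x ^ 2 - s j)
    (by fun_prop) (by fun_prop)
  rw [h.integral_fun_mul_eq_mul_integral (hu.memLp_sq_sub i).aestronglyMeasurable
    (hu.memLp_sq_sub j).aestronglyMeasurable, hu.integral_sq_sub i, zero_mul]

theorem integral_crossForm_sq (hu : IsCenteredFamily μ u s M) (a : Matrix ι ι ℝ) (S : Finset ι)
    (k : ι) : ∫ ω, (crossForm a S k fun i => u i ω) ^ 2 ∂μ
      = ∑ j ∈ S, (a k j + a j k) ^ 2 * s j := by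
  have := integral_sum_mul_sum (μ := μ) (Z := u)
    (fun i j => (hu.memLp_mul i j).integrable (by norm_num))
    (fun i j hij => hu.integral_mul_of_ne hij) S (fun j => a k j + a j k) (fun j => a k j + a j k)
  simp only [crossForm, pow_two] at this ⊢
  rw [this]
  refine Finset.sum_congr rfl fun j _ => ?_
  rw [← hu.var j]; simp only [pow_two]

/-- Covariance of two diagonal quadratic forms. -/
theorem integral_diag_mul_diag (hu : IsCenteredFamily μ u s M) [Fintype ι] (f g : ι → ℝ) :
    ∫ ω, (∑ i, f i * (u i ω ^ 2 - s i)) * (∑ i, g i * (u i ω ^ 2 - s i)) ∂μ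
      = ∑ i, f i * g i * ∫ ω, (u i ω ^ 2 - s i) ^ 2 ∂μ :=
  integral_sum_mul_sum (fun i j => integrable_mul_of_memLp_three (hu.memLp_sq_sub i)
    (hu.memLp_sq_sub j)) (fun _ _ hij => hu.integral_sq_sub_mul_of_ne hij) _ f g

theorem integral_abs_sq_sub_pow_three_le (hu : IsCenteredFamily μ u s M) (i : ι) :
    ∫ ω, |u i ω ^ 2 - s i| ^ 3 ∂μ ≤ 4 * (M + (1 + M) ^ 3) := by
  have hint := integrable_pow_six (hu.memLp i)
  have hs := hu.var_nonneg i
  calc _ ≤ ∫ ω, (4 * (u i ω ^ 6 + s i ^ 3)) ∂μ := by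
        refine integral_mono (hu.memLp_sq_sub i).integrable_abs_pow_three
          ((hint.add (integrable_const _)).const_mul _) fun ω => ?_
        calc |u i ω ^ 2 - s i| ^ 3 ≤ (u i ω ^ 2 + s i) ^ 3 := by
              gcongr
              refine (abs_sub _ _).trans (le_of_eq ?_)
              rw [abs_of_nonneg hs, abs_of_nonneg (sq_nonneg _)]
          _ ≤ 4 * ((u i ω ^ 2) ^ 3 + s i ^ 3) := add_pow_three_le (sq_nonneg _) hs
          _ = _ := by ring
    _ = 4 * (∫ ω, u i ω ^ 6 ∂μ + s i ^ 3) := by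
        rw [integral_const_mul, integral_add hint (integrable_const _)]; simp
    _ ≤ _ := by
        have := hu.sixth i
        have := hu.var_le i
        gcongr

theorem integral_sq_sub_sq_le (hu : IsCenteredFamily μ u s M) (i : ι) :
    ∫ ω, (u i ω ^ 2 - s i) ^ 2 ∂μ ≤ 1 + M := by
  have h4 := integrable_pow_of_memLp_six (hu.memLp i) (k := 4) (by norm_num)
  have h2 := integrable_pow_of_memLp_six (hu.memLp i) (k := 2) (by norm_num)
  have : ∫ ω, (u i ω ^ 2 - s i) ^ 2 ∂μ = ∫ ω, u i ω ^ 4 ∂μ - s i ^ 2 := by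
    calc _ = ∫ ω, (u i ω ^ 4 - 2 * s i * u i ω ^ 2 + s i ^ 2) ∂μ :=
          integral_congr_ae (ae_of_all _ fun ω => by ring)
      _ = _ := by
          have h := h4.sub (h2.const_mul (2 * s i))
          simp only [Pi.sub_def] at h
          rw [integral_add h (integrable_const _), integral_sub h4 (h2.const_mul _),
            integral_const_mul, hu.var i]
          simp only [integral_const, probReal_univ, smul_eq_mul]
          ring
  rw [this]
  have h := hu.integral_abs_pow_le i (k := 4) (by norm_num)
  have e : ∀ ω, |u i ω| ^ 4 = u i ω ^ 4 := fun ω => (even_two_mul 2).pow_abs _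
  simp only [e] at h
  nlinarith [sq_nonneg (s i)]

variable [Fintype ι]

theorem integral_abs_quadIncrement_pow_three_le (hu : IsCenteredFamily μ u s M)
    {a : Matrix ι ι ℝ} {K : ℝ} (hK : 0 ≤ K) {S : Finset ι} {k : ι} (hk : k ∉ S)
    (hd : ∀ i, |a i i| ≤ K) (ha : ∀ i j, i ≠ j → |a i j| ≤ K / Fintype.card ι) :
    ∫ ω, |quadIncrement s a S k fun i => u i ω| ^ 3 ∂μ
      ≤ (16 * (M + (1 + M) ^ 3) + 64 * M) * K ^ 3 := by
  have h₁ := (hu.memLp_sq_sub k).integrable_abs_pow_three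
  have h₂ := (hu.memLp_mul_crossForm a S k).integrable_abs_pow_three
  have b₁ := hu.integral_abs_sq_sub_pow_three_le k
  have b₂ := hu.integral_abs_mul_crossForm_pow_three_le hK hk ha
  calc _ ≤ ∫ ω, (4 * K ^ 3 * |u k ω ^ 2 - s k| ^ 3
        + 4 * |u k ω * crossForm a S k fun i => u i ω| ^ 3) ∂μ := by
        refine integral_mono (hu.memLp_quadIncrement a S k).integrable_abs_pow_three
          ((h₁.const_mul _).add (h₂.const_mul _)) fun ω => ?_
        calc _ ≤ (K * |u k ω ^ 2 - s k| + |u k ω * crossForm a S k fun i => u i ω|) ^ 3 := by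
              gcongr
              refine (abs_add_le _ _).trans ?_
              rw [abs_mul]
              gcongr
              exact hd k
          _ ≤ 4 * ((K * |u k ω ^ 2 - s k|) ^ 3
                + |u k ω * crossForm a S k fun i => u i ω| ^ 3) :=
              add_pow_three_le (by positivity) (abs_nonneg _)
          _ = _ := by ring
    _ = 4 * K ^ 3 * ∫ ω, |u k ω ^ 2 - s k| ^ 3 ∂μ
        + 4 * ∫ ω, |u k ω * crossForm a S k fun i => u i ω| ^ 3 ∂μ := by
        rw [integral_add (h₁.const_mul _) (h₂.const_mul _), integral_const_mul,
          integral_const_mul]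
    _ ≤ 4 * K ^ 3 * (4 * (M + (1 + M) ^ 3)) + 4 * (16 * K ^ 3 * M) := by gcongr
    _ = _ := by ring

/-- An elementary substitute for Burkholder's inequality. When an index is added, let `x` be the old
form and `z` its increment. In the bound for `|x + z|³` the term `3 x|x| z` integrates to zero, and
`3|x| z² ≤ |x|³/n + 2√n |z|³`. So one step multiplies the third moment by `1 + 1/n` and adds at most
`(2√n + 1) Z`; after `n` steps this gives at most `3 · n · 3√n · Z`. -/
theorem integral_abs_quadOn_pow_three_le (hu : IsCenteredFamily μ u s M) (hM : 0 ≤ M)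
    {a : Matrix ι ι ℝ} {K : ℝ} (hK : 0 ≤ K) (hd : ∀ i, |a i i| ≤ K)
    (ha : ∀ i j, i ≠ j → |a i j| ≤ K / Fintype.card ι) :
    ∫ ω, |quadOn s a Finset.univ fun i => u i ω| ^ 3 ∂μ
      ≤ 9 * ((16 * (M + (1 + M) ^ 3) + 64 * M) * K ^ 3) * √(Fintype.card ι) ^ 3 := by
  classical
  set Z := (16 * (M + (1 + M) ^ 3) + 64 * M) * K ^ 3
  have hZ : 0 ≤ Z := by positivity
  rcases isEmpty_or_nonempty ι with hι | hι
  · simp only [quadOn, Finset.univ_eq_empty, Finset.sum_empty, sub_zero, abs_zero]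
    simp only [ne_eq, OfNat.ofNat_ne_zero, not_false_eq_true, zero_pow, integral_zero]
    positivity
  have hcard : 0 < Fintype.card ι := Fintype.card_pos
  set N := Fintype.card ι
  set r := √(N : ℝ) with hr_def
  have hN1 : (1 : ℝ) ≤ N := by exact_mod_cast hcard
  have hr2 : r ^ 2 = N := Real.sq_sqrt (by positivity)
  have hr1 : 1 ≤ r := by rw [hr_def]; exact Real.one_le_sqrt.2 hN1
  have hr : 0 < r := by linarith
  have main : ∀ S : Finset ι, ∫ ω, |quadOn s a S fun i => u i ω| ^ 3 ∂μ
      ≤ (1 + 1 / r ^ 2) ^ S.card * (S.card * ((2 * r + 1) * Z)) := by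
    intro S
    induction S using Finset.induction_on with
    | empty => simp [quadOn]
    | insert k S hk ih =>
      have hG := hu.memLp_quadOn a S
      have hz := hu.memLp_quadIncrement a S k
      have horth := hu.integral_mul_quadIncrement a hk
        (Ψ := fun x => quadOn s a S x * |quadOn s a S x|)
        (measurable_quadOn.mul measurable_quadOn.norm)
        (fun x y h => by simp only [quadOn_congr h]) (integrable_mul_abs_self hG)
        (integrable_mul_abs_mul hG (hu.memLp_crossForm a S k))
      have hzb := hu.integral_abs_quadIncrement_pow_three_le hK hk hd ha
      have i1 := hG.integrable_abs_pow_three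
      have i2 := hz.integrable_abs_pow_three
      have i3 := integrable_mul_abs_mul hG hz
      calc _ ≤ ∫ ω, ((1 + 1 / r ^ 2) * |quadOn s a S fun i => u i ω| ^ 3
              + (2 * r + 1) * |quadIncrement s a S k fun i => u i ω| ^ 3
              + 3 * ((quadOn s a S fun i => u i ω) * |quadOn s a S fun i => u i ω|
                * quadIncrement s a S k fun i => u i ω)) ∂μ := by
            refine integral_mono (hu.memLp_quadOn a _).integrable_abs_pow_three
              (((i1.const_mul _).add (i2.const_mul _)).add (i3.const_mul _)) fun ω => ?_
            simp only [quadOn_insert hk]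
            generalize (quadOn s a S fun i => u i ω) = x
            generalize (quadIncrement s a S k fun i => u i ω) = z
            have h1 := abs_add_pow_three_le x z
            have h2 := three_mul_mul_sq_le (abs_nonneg x) (abs_nonneg z) hr
            rw [sq_abs] at h2
            have h3 : (1 + 1 / r ^ 2) * |x| ^ 3 = |x| ^ 3 + |x| ^ 3 / r ^ 2 := by ring
            rw [h3]
            linarith
        _ = (1 + 1 / r ^ 2) * ∫ ω, |quadOn s a S fun i => u i ω| ^ 3 ∂μ
              + (2 * r + 1) * ∫ ω, |quadIncrement s a S k fun i => u i ω| ^ 3 ∂μ := by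
            rw [integral_add ((i1.const_mul _).fun_add (i2.const_mul _)) (i3.const_mul _),
              integral_add (i1.const_mul _) (i2.const_mul _), integral_const_mul,
              integral_const_mul, integral_const_mul, horth, mul_zero, add_zero]
        -- The new increment is inflated by a factor that is at least `1`, so that it shares the
        -- power of the induction claim.
        _ ≤ (1 + 1 / r ^ 2) * ((1 + 1 / r ^ 2) ^ S.card * (S.card * ((2 * r + 1) * Z)))
              + (1 + 1 / r ^ 2) ^ (S.card + 1) * ((2 * r + 1) * Z) := by
            have h1 : (1 : ℝ) ≤ (1 + 1 / r ^ 2) ^ (S.card + 1) :=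
              one_le_pow₀ (by have : 0 ≤ 1 / r ^ 2 := by positivity
                              linarith)
            have h2 : 0 ≤ (2 * r + 1) * Z := by positivity
            refine add_le_add (by gcongr) ?_
            calc _ ≤ (2 * r + 1) * Z := by gcongr
              _ = 1 * ((2 * r + 1) * Z) := (one_mul _).symm
              _ ≤ _ := by gcongr
        _ = _ := by
            rw [Finset.card_insert_of_notMem hk]
            push_cast
            ring
  refine (main Finset.univ).trans ?_
  have hcu : (Finset.univ : Finset ι).card = N := rfl
  rw [hcu]
  have hexp : (1 + 1 / r ^ 2) ^ N ≤ 3 := by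
    calc (1 + 1 / r ^ 2) ^ N ≤ Real.exp (1 / r ^ 2) ^ N := by
          gcongr
          rw [add_comm]; exact Real.add_one_le_exp _
      _ = Real.exp 1 := by
          rw [← Real.exp_nat_mul, hr2]
          congr 1
          field_simp
      _ ≤ 3 := by linarith [Real.exp_one_lt_d9]
  -- Here `2r + 1 ≤ 3r` because `r ≥ 1`.
  calc _ ≤ 3 * (N * ((2 * r + r) * Z)) := by gcongr
    _ = 9 * Z * r ^ 3 := by rw [← hr2]; ring

/-- With the diagonal of order `1/n` as well, an increment has second moment `O(1/n)`: the cross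
term is a product of independent factors, and its linear form is a sum of at most `n` orthogonal
terms of variance `O(1/n²)`. The `n` orthogonal increments then add up to `O(1)`. -/
theorem integral_quadIncrement_sq_le (hu : IsCenteredFamily μ u s M)
    {a : Matrix ι ι ℝ} {K : ℝ} {S : Finset ι} {k : ι} (hk : k ∉ S)
    (ha : ∀ i j, |a i j| ≤ K / Fintype.card ι) :
    ∫ ω, (quadIncrement s a S k fun i => u i ω) ^ 2 ∂μ
      ≤ (2 * (1 + M) + 8 * (1 + M) ^ 2) * K ^ 2 / Fintype.card ι := by
  have hM := hu.nonneg_of_index k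
  have hn : (1 : ℝ) ≤ Fintype.card ι := by
    exact_mod_cast Nat.one_le_iff_ne_zero.2 (Fintype.card_pos_iff.2 ⟨k⟩).ne'
  set n : ℝ := ((Fintype.card ι : ℕ) : ℝ)
  have hSn : (S.card : ℝ) ≤ n := Nat.cast_le.2 S.card_le_univ
  have h₁ := integrable_sq_of_memLp_three (hu.memLp_sq_sub k)
  have h₂ := integrable_sq_of_memLp_three (hu.memLp_mul_crossForm a S k)
  have hL := integrable_sq_of_memLp_three (hu.memLp_crossForm a S k)
  have hind := (hu.indepFun_of_notMem hk (Ψ := fun x => crossForm a S k x ^ 2)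
    (measurable_crossForm.pow_const 2) (fun x y h => by simp only [crossForm_congr h])
    (θ := fun x => x ^ 2) (by fun_prop)).integral_fun_mul_eq_mul_integral
      hL.aestronglyMeasurable ((hu.measurable k).pow_const 2).aestronglyMeasurable
  have b₂ : ∫ ω, (u k ω * crossForm a S k fun i => u i ω) ^ 2 ∂μ
      ≤ (4 * K ^ 2 * (1 + M) / n) * (1 + M) := by
    calc _ = ∫ ω, (crossForm a S k fun i => u i ω) ^ 2 * u k ω ^ 2 ∂μ :=
          integral_congr_ae (ae_of_all _ fun ω => by ring)
      _ = (∑ j ∈ S, (a k j + a j k) ^ 2 * s j) * s k := by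
          rw [hind, hu.integral_crossForm_sq, hu.var k]
      _ ≤ (∑ j ∈ S, (2 * K / n) ^ 2 * (1 + M)) * (1 + M) := by
          have hsk := hu.var_nonneg k
          have hsk' := hu.var_le k
          have hj : ∀ j, (a k j + a j k) ^ 2 ≤ (2 * K / n) ^ 2 := fun j => by
            rw [← sq_abs]
            refine pow_le_pow_left₀ (abs_nonneg _) ?_ 2
            exact (abs_add_le _ _).trans ((add_le_add (ha k j) (ha j k)).trans
              (le_of_eq (by ring)))
          refine mul_le_mul (Finset.sum_le_sum fun j _ => ?_) hsk' hsk (by positivity)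
          exact mul_le_mul (hj j) (hu.var_le j) (hu.var_nonneg j) (by positivity)
      _ = (S.card * ((2 * K / n) ^ 2 * (1 + M))) * (1 + M) := by
          rw [Finset.sum_const, nsmul_eq_mul]
      _ ≤ (n * ((2 * K / n) ^ 2 * (1 + M))) * (1 + M) := by gcongr
      _ = _ := by field_simp; ring
  calc _ ≤ ∫ ω, (2 * (K / n) ^ 2 * (u k ω ^ 2 - s k) ^ 2
        + 2 * (u k ω * crossForm a S k fun i => u i ω) ^ 2) ∂μ := by
        refine integral_mono (integrable_sq_of_memLp_three (hu.memLp_quadIncrement a S k))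
          ((h₁.const_mul _).add (h₂.const_mul _)) fun ω => ?_
        have e : a k k ^ 2 ≤ (K / n) ^ 2 := by
          rw [← sq_abs]; exact pow_le_pow_left₀ (abs_nonneg _) (ha k k) 2
        have e' := mul_le_mul_of_nonneg_right e (sq_nonneg (u k ω ^ 2 - s k))
        simp only [quadIncrement]
        nlinarith [sq_nonneg (a k k * (u k ω ^ 2 - s k)
          - u k ω * crossForm a S k fun i => u i ω)]
    _ = 2 * (K / n) ^ 2 * ∫ ω, (u k ω ^ 2 - s k) ^ 2 ∂μ
        + 2 * ∫ ω, (u k ω * crossForm a S k fun i => u i ω) ^ 2 ∂μ := by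
        rw [integral_add (h₁.const_mul _) (h₂.const_mul _), integral_const_mul,
          integral_const_mul]
    _ ≤ 2 * (K ^ 2 / n) * (1 + M) + 2 * ((4 * K ^ 2 * (1 + M) / n) * (1 + M)) := by
        have e : (K / n) ^ 2 ≤ K ^ 2 / n := by
          rw [div_pow]
          gcongr
          nlinarith
        have := hu.integral_sq_sub_sq_le k
        have : 0 ≤ ∫ ω, (u k ω ^ 2 - s k) ^ 2 ∂μ := by positivity
        gcongr
    _ = _ := by ring

/-- A quadratic form with entries of order `1 / n` has bounded variance. -/
theorem integral_quadOn_sq_le (hu : IsCenteredFamily μ u s M) (hM : 0 ≤ M)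
    {a : Matrix ι ι ℝ} {K : ℝ} (ha : ∀ i j, |a i j| ≤ K / Fintype.card ι) :
    ∫ ω, (quadOn s a Finset.univ fun i => u i ω) ^ 2 ∂μ
      ≤ (2 * (1 + M) + 8 * (1 + M) ^ 2) * K ^ 2 := by
  classical
  have main : ∀ S : Finset ι, ∫ ω, (quadOn s a S fun i => u i ω) ^ 2 ∂μ
      ≤ S.card * ((2 * (1 + M) + 8 * (1 + M) ^ 2) * K ^ 2 / Fintype.card ι) := by
    intro S
    induction S using Finset.induction_on with
    | empty => simp [quadOn]
    | insert k S hk ih =>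
      have hG := hu.memLp_quadOn a S
      have hz := hu.memLp_quadIncrement a S k
      have horth := hu.integral_mul_quadIncrement a hk (Ψ := fun x => quadOn s a S x)
        measurable_quadOn (fun x y h => quadOn_congr h) (hG.integrable (by norm_num))
        (integrable_mul_of_memLp_three hG (hu.memLp_crossForm a S k))
      have hzb := hu.integral_quadIncrement_sq_le hk ha
      have i1 := integrable_sq_of_memLp_three hG
      have i2 := integrable_sq_of_memLp_three hz
      have i3 := integrable_mul_of_memLp_three hG hz
      calc _ = ∫ ω, ((quadOn s a S fun i => u i ω) ^ 2
              + (quadIncrement s a S k fun i => u i ω) ^ 2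
              + 2 * ((quadOn s a S fun i => u i ω)
                * quadIncrement s a S k fun i => u i ω)) ∂μ := by
            refine integral_congr_ae (ae_of_all _ fun ω => ?_)
            simp only [quadOn_insert hk]
            ring
        _ = ∫ ω, (quadOn s a S fun i => u i ω) ^ 2 ∂μ
              + ∫ ω, (quadIncrement s a S k fun i => u i ω) ^ 2 ∂μ := by
            rw [integral_add (i1.fun_add i2) (i3.const_mul _),
              integral_add i1 i2, integral_const_mul, horth, mul_zero, add_zero]
        _ ≤ _ := by
            rw [Finset.card_insert_of_notMem hk]
            push_cast
            linarith
  refine (main Finset.univ).trans ?_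
  rcases Nat.eq_zero_or_pos (Fintype.card ι) with h | h
  · rw [Finset.card_univ, h]
    simp only [Nat.cast_zero, zero_mul]
    positivity
  · have : (0 : ℝ) < Fintype.card ι := by exact_mod_cast h
    rw [Finset.card_univ]
    exact le_of_eq (by field_simp)

end IsCenteredFamily
/-! ### Covariances of quadratic forms that are nearly diagonal -/

/-- A weighted form of Cauchy–Schwarz. With `r = √n` it balances a factor of second moment `O(n)`
against one of second moment `O(1)`, and yields `O(√n)`. -/
theorem abs_integral_mul_le {Ω : Type*} [MeasurableSpace Ω] {μ : Measure Ω} {f g : Ω → ℝ} {r : ℝ}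
    (hr : 0 < r) (hf : Integrable (fun ω => f ω ^ 2) μ) (hg : Integrable (fun ω => g ω ^ 2) μ) :
    |∫ ω, f ω * g ω ∂μ| ≤ (1 / r) * ∫ ω, f ω ^ 2 ∂μ + r * ∫ ω, g ω ^ 2 ∂μ := by
  rw [← integral_const_mul, ← integral_const_mul,
    ← integral_add (hf.const_mul _) (hg.const_mul _), ← Real.norm_eq_abs]
  refine norm_integral_le_of_norm_le ((hf.const_mul _).add (hg.const_mul _))
    (ae_of_all _ fun ω => ?_)
  rw [Real.norm_eq_abs, abs_mul, ← sq_abs (f ω), ← sq_abs (g ω)]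
  generalize |f ω| = x
  generalize |g ω| = y
  have : 1 / r * x ^ 2 + r * y ^ 2 - x * y
      = (1 / r) * ((x - r * y / 2) ^ 2 + 3 / 4 * (r * y) ^ 2) := by field_simp; ring
  have : 0 ≤ (1 / r) * ((x - r * y / 2) ^ 2 + 3 / 4 * (r * y) ^ 2) := by positivity
  linarith

theorem quadOn_diagonal_add {ι : Type*} [Fintype ι] [DecidableEq ι] (s w : ι → ℝ)
    (P : Matrix ι ι ℝ) (x : ι → ℝ) :
    quadOn s (diagonal w + P) Finset.univ x
      = ∑ i, w i * (x i ^ 2 - s i) + quadOn s P Finset.univ x := by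
  simp only [quadOn, Matrix.add_apply, add_mul, Finset.sum_add_distrib, mul_sub,
    Finset.sum_sub_distrib,
    diagonal_apply, ite_mul, zero_mul, Finset.sum_ite_eq, Finset.mem_univ, if_true, pow_two]
  ring

namespace IsCenteredFamily

variable {Ω ι : Type*} [MeasurableSpace Ω] {μ : Measure Ω} {u : ι → Ω → ℝ} {s : ι → ℝ} {M : ℝ}
  [IsProbabilityMeasure μ] [Fintype ι]

theorem abs_sum_mul_le (hu : IsCenteredFamily μ u s M) {K : ℝ} {w w' : ι → ℝ}
    (hw : ∀ i, |w i| ≤ K) (hw' : ∀ i, |w' i| ≤ K) :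
    |∑ i, w i * w' i * ∫ ω, (u i ω ^ 2 - s i) ^ 2 ∂μ| ≤ (1 + M) * K ^ 2 * Fintype.card ι := by
  refine (Finset.abs_sum_le_sum_abs _ _).trans ?_
  calc _ ≤ ∑ _i : ι, K * K * (1 + M) := by
        refine Finset.sum_le_sum fun i _ => ?_
        have h1 := hu.integral_sq_sub_sq_le i
        have h2 : 0 ≤ ∫ ω, (u i ω ^ 2 - s i) ^ 2 ∂μ := by positivity
        have hK : 0 ≤ K := (abs_nonneg _).trans (hw i)
        rw [abs_mul, abs_mul, abs_of_nonneg h2]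
        have := hw i
        have := hw' i
        gcongr
    _ = _ := by
        rw [Finset.sum_const, nsmul_eq_mul, Finset.card_univ]; ring

/-- In the expanded product, diagonal times diagonal is exact by orthogonality. The two mixed terms
are `O(√n)` by the weighted inequality, and the product of the two perturbations is `O(1)`. -/
theorem abs_integral_quadOn_mul_sub_le [DecidableEq ι] (hu : IsCenteredFamily μ u s M)
    (hM : 0 ≤ M) (hι : 0 < Fintype.card ι)
    {K : ℝ} {w w' : ι → ℝ} {P P' : Matrix ι ι ℝ} (hw : ∀ i, |w i| ≤ K) (hw' : ∀ i, |w' i| ≤ K)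
    (hP : ∀ i j, |P i j| ≤ K / Fintype.card ι) (hP' : ∀ i j, |P' i j| ≤ K / Fintype.card ι) :
    |∫ ω, (quadOn s (diagonal w + P) Finset.univ fun i => u i ω)
        * (quadOn s (diagonal w' + P') Finset.univ fun i => u i ω) ∂μ
      - ∑ i, w i * w' i * ∫ ω, (u i ω ^ 2 - s i) ^ 2 ∂μ|
      ≤ (2 * (1 + M) + 4 * (2 * (1 + M) + 8 * (1 + M) ^ 2)) * K ^ 2 * √(Fintype.card ι) := by
  have hn1 : (1 : ℝ) ≤ Fintype.card ι := by exact_mod_cast hι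
  have hr2 : √(Fintype.card ι : ℝ) ^ 2 = Fintype.card ι := Real.sq_sqrt (by positivity)
  have hr1 : 1 ≤ √(Fintype.card ι : ℝ) := Real.one_le_sqrt.2 hn1
  set r := √(Fintype.card ι : ℝ)
  have hr : 0 < r := by linarith
  set Y := (2 * (1 + M) + 8 * (1 + M) ^ 2) with hY_def
  have hY : 0 ≤ Y := by positivity
  have hD : ∀ w : ι → ℝ, MemLp (fun ω => ∑ i, w i * (u i ω ^ 2 - s i)) 3 μ := fun w =>
    memLp_finsetSum _ fun i _ => (hu.memLp_sq_sub i).const_mul _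
  have hDsq : ∀ w : ι → ℝ, (∀ i, |w i| ≤ K) →
      ∫ ω, (∑ i, w i * (u i ω ^ 2 - s i)) ^ 2 ∂μ ≤ (1 + M) * K ^ 2 * r ^ 2 := fun w hw => by
    simp only [pow_two (∑ i, _)]
    rw [hu.integral_diag_mul_diag w w, hr2]
    exact (le_abs_self _).trans (hu.abs_sum_mul_le hw hw)
  have hQ := fun P : Matrix ι ι ℝ => hu.memLp_quadOn P Finset.univ
  have hQsq := fun (P : Matrix ι ι ℝ) (hP : ∀ i j, |P i j| ≤ K / Fintype.card ι) =>
    hu.integral_quadOn_sq_le hM hP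
  simp only [quadOn_diagonal_add]
  have e : ∀ ω, ((∑ i, w i * (u i ω ^ 2 - s i)) + quadOn s P Finset.univ fun i => u i ω)
      * ((∑ i, w' i * (u i ω ^ 2 - s i)) + quadOn s P' Finset.univ fun i => u i ω)
      = (∑ i, w i * (u i ω ^ 2 - s i)) * (∑ i, w' i * (u i ω ^ 2 - s i))
        + ((∑ i, w i * (u i ω ^ 2 - s i)) * (quadOn s P' Finset.univ fun i => u i ω)
        + ((∑ i, w' i * (u i ω ^ 2 - s i)) * (quadOn s P Finset.univ fun i => u i ω)
        + (quadOn s P Finset.univ fun i => u i ω) * quadOn s P' Finset.univ fun i => u i ω)) :=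
    fun ω => by ring
  simp only [e]
  have i1 := integrable_mul_of_memLp_three (hD w) (hD w')
  have i2 := integrable_mul_of_memLp_three (hD w) (hQ P')
  have i3 := integrable_mul_of_memLp_three (hD w') (hQ P)
  have i4 := integrable_mul_of_memLp_three (hQ P) (hQ P')
  rw [integral_add i1 (i2.fun_add (i3.fun_add i4)), integral_add i2 (i3.fun_add i4),
    integral_add i3 i4, hu.integral_diag_mul_diag, add_sub_cancel_left]
  have b : ∀ (w : ι → ℝ) (P : Matrix ι ι ℝ), (∀ i, |w i| ≤ K) →
      (∀ i j, |P i j| ≤ K / Fintype.card ι) →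
      |∫ ω, (∑ i, w i * (u i ω ^ 2 - s i)) * (quadOn s P Finset.univ fun i => u i ω) ∂μ|
        ≤ ((1 + M) + Y) * K ^ 2 * r := by
    intro w P hw hP
    refine (abs_integral_mul_le hr (integrable_sq_of_memLp_three (hD w))
      (integrable_sq_of_memLp_three (hQ P))).trans ?_
    calc _ ≤ (1 / r) * ((1 + M) * K ^ 2 * r ^ 2) + r * (Y * K ^ 2) := by
          have := hDsq w hw
          have := hQsq P hP
          gcongr
      _ = _ := by field_simp
  have b4 := abs_integral_mul_le one_pos (integrable_sq_of_memLp_three (hQ P))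
      (integrable_sq_of_memLp_three (hQ P'))
  have b2 := b w P' hw hP'
  have b3 := b w' P hw' hP
  have c1 := hQsq P hP
  have c2 := hQsq P' hP'
  refine (abs_add_le _ _).trans ?_
  have h34 := abs_add_le
    (∫ ω, (∑ i, w' i * (u i ω ^ 2 - s i)) * (quadOn s P Finset.univ fun i => u i ω) ∂μ)
    (∫ ω, (quadOn s P Finset.univ fun i => u i ω) * quadOn s P' Finset.univ fun i => u i ω ∂μ)
  have h5 : 2 * (Y * K ^ 2) ≤ 2 * (Y * K ^ 2) * r := le_mul_of_one_le_right (by positivity) hr1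
  have h6 : (2 * (1 + M) + 4 * Y) * K ^ 2 * r
      = ((1 + M) + Y) * K ^ 2 * r + ((1 + M) + Y) * K ^ 2 * r + 2 * (Y * K ^ 2) * r := by ring
  rw [h6]
  linarith

end IsCenteredFamily

/-! ### Uniform control of a process through its derivative -/

/-- A one-dimensional Sobolev bound: `f³` has derivative `3 f² g`, and `3 f² |g| ≤ 2|f|³ + |g|³` by
Young. The bound `C` only ensures integrability and does not enter the estimate. -/
theorem abs_pow_three_le_add_integral {f g : ℝ → ℝ} {a b C x t : ℝ}
    (hf : Measurable f) (hg : Measurable g) (hd : ∀ s ∈ Ioo a b, HasDerivAt f (g s) s)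
    (hfC : ∀ s ∈ Ioo a b, |f s| ≤ C) (hgC : ∀ s ∈ Ioo a b, |g s| ≤ C)
    (hx : x ∈ Ioo a b) (ht : t ∈ Ioo a b) :
    IntegrableOn (fun s => 2 * |f s| ^ 3 + |g s| ^ 3) (Ioo a b) ∧
    |f t| ^ 3 ≤ |f x| ^ 3 + ∫ s in Ioo a b, (2 * |f s| ^ 3 + |g s| ^ 3) := by
  have hC : 0 ≤ C := (abs_nonneg _).trans (hfC x hx)
  have hint : IntegrableOn (fun s => 2 * |f s| ^ 3 + |g s| ^ 3) (Ioo a b) := by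
    refine Measure.integrableOn_of_bounded (M := 2 * C ^ 3 + C ^ 3) (by simp) ?_ ?_
    · exact (((hf.norm.pow_const 3).const_mul 2).add (hg.norm.pow_const 3)).aestronglyMeasurable
    · refine (ae_restrict_iff' measurableSet_Ioo).2 (ae_of_all _ fun s hs => ?_)
      rw [Real.norm_eq_abs, abs_of_nonneg (by positivity)]
      have := hfC s hs
      have := hgC s hs
      gcongr
  refine ⟨hint, ?_⟩
  have hsub : uIcc x t ⊆ Ioo a b := ordConnected_Ioo.uIcc_subset hx ht
  have hsub' : uIoc x t ⊆ Ioo a b := uIoc_subset_uIcc.trans hsub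
  have hle : ∀ s, ‖3 * f s ^ 2 * g s‖ ≤ 2 * |f s| ^ 3 + |g s| ^ 3 := fun s => by
    have := three_mul_mul_sq_le (abs_nonneg (g s)) (abs_nonneg (f s)) one_pos
    rw [Real.norm_eq_abs, abs_mul, abs_mul, abs_pow, abs_of_nonneg (by norm_num : (0 : ℝ) ≤ 3)]
    linarith
  have hint' : IntegrableOn (fun s => 3 * f s ^ 2 * g s) (Ioo a b) :=
    Integrable.mono' hint (((hf.pow_const 2).const_mul 3).mul hg).aestronglyMeasurable
      (ae_of_all _ hle)
  have hftc := intervalIntegral.integral_eq_sub_of_hasDerivAt (a := x) (b := t)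
    (f := fun s => f s ^ 3) (f' := fun s => 3 * f s ^ 2 * g s)
    (fun s hs => by simpa using (hd s (hsub hs)).fun_pow 3)
    (intervalIntegrable_iff.2 (hint'.mono_set hsub'))
  have h1 : |f t ^ 3 - f x ^ 3| ≤ ∫ s in Ioo a b, (2 * |f s| ^ 3 + |g s| ^ 3) := by
    rw [← hftc, ← Real.norm_eq_abs]
    refine intervalIntegral.norm_integral_le_integral_norm_uIoc.trans ?_
    refine (setIntegral_mono_set hint'.norm (ae_of_all _ fun _ => norm_nonneg _)
      hsub'.eventuallyLE).trans ?_
    exact integral_mono hint'.norm hint hle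
  have h2 := abs_sub_abs_le_abs_sub (f t ^ 3) (f x ^ 3)
  rw [abs_pow, abs_pow] at h2
  linarith

/-- A process with differentiable paths is dominated, uniformly in `t`, by a random variable whose
mean is controlled by the third moments of the process and of its derivative. -/
theorem exists_dominating_of_hasDerivAt {Ω : Type*} [MeasurableSpace Ω] {μ : Measure Ω}
    [SFinite μ] {G G' : ℝ → Ω → ℝ} {a b B x : ℝ} (hx : x ∈ Ioo a b)
    (hG : Measurable fun z : ℝ × Ω => G z.1 z.2) (hG' : Measurable fun z : ℝ × Ω => G' z.1 z.2)
    (hd : ∀ ω, ∀ t ∈ Ioo a b, HasDerivAt (fun t => G t ω) (G' t ω) t)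
    (hC : ∀ ω, ∃ C, ∀ t ∈ Ioo a b, |G t ω| ≤ C) (hC' : ∀ ω, ∃ C, ∀ t ∈ Ioo a b, |G' t ω| ≤ C)
    (hi : ∀ t, Integrable (fun ω => |G t ω| ^ 3) μ)
    (hi' : ∀ t, Integrable (fun ω => |G' t ω| ^ 3) μ)
    (hB : ∀ t ∈ Ioo a b, ∫ ω, |G t ω| ^ 3 ∂μ ≤ B)
    (hB' : ∀ t ∈ Ioo a b, ∫ ω, |G' t ω| ^ 3 ∂μ ≤ B) :
    ∃ V : Ω → ℝ, Measurable V ∧ (∀ ω, 0 ≤ V ω) ∧ Integrable V μ ∧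
      ∫ ω, V ω ∂μ ≤ (1 + 3 * (b - a)) * B ∧ ∀ ω, ∀ t ∈ Ioo a b, |G t ω| ^ 3 ≤ V ω := by
  have hB0 : 0 ≤ B := (integral_nonneg fun ω => by positivity).trans (hB x hx)
  have hab : 0 ≤ b - a := by linarith [hx.1, hx.2]
  have key : ∀ ω, ∀ t ∈ Ioo a b,
      IntegrableOn (fun r => 2 * |G r ω| ^ 3 + |G' r ω| ^ 3) (Ioo a b) ∧
      |G t ω| ^ 3 ≤ |G x ω| ^ 3 + ∫ r in Ioo a b, (2 * |G r ω| ^ 3 + |G' r ω| ^ 3) := by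
    intro ω t ht
    obtain ⟨C₁, hC₁⟩ := hC ω
    obtain ⟨C₂, hC₂⟩ := hC' ω
    exact abs_pow_three_le_add_integral (C := max C₁ C₂) (hG.comp measurable_prodMk_right)
      (hG'.comp measurable_prodMk_right) (hd ω)
      (fun r hr => (hC₁ r hr).trans (le_max_left _ _))
      (fun r hr => (hC₂ r hr).trans (le_max_right _ _)) hx ht
  set H : ℝ × Ω → ℝ := fun z => 2 * |G z.1 z.2| ^ 3 + |G' z.1 z.2| ^ 3 with hH
  have hH0 : ∀ z, 0 ≤ H z := fun z => by simp only [hH]; positivity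
  have hHm : Measurable H := ((hG.norm.pow_const 3).const_mul 2).add (hG'.norm.pow_const 3)
  have hIm : Measurable fun ω => ∫ r in Ioo a b, H (r, ω) :=
    hHm.stronglyMeasurable.integral_prod_left'.measurable
  have hI0 : ∀ ω, 0 ≤ ∫ r in Ioo a b, H (r, ω) := fun ω => integral_nonneg fun r => hH0 _
  -- Tonelli in `ℝ≥0∞` needs no prior integrability on the product and yields it for the inner
  -- integral. The constant is `2B + B` times the length `b - a`.
  have hlint : ∫⁻ ω, ENNReal.ofReal (∫ r in Ioo a b, H (r, ω)) ∂μ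
      ≤ ENNReal.ofReal (3 * (b - a) * B) := by
    calc _ = ∫⁻ ω, (∫⁻ r in Ioo a b, ENNReal.ofReal (H (r, ω))) ∂μ :=
          lintegral_congr fun ω => ofReal_integral_eq_lintegral_ofReal (key ω x hx).1
            (ae_of_all _ fun r => hH0 _)
      _ = ∫⁻ r in Ioo a b, ∫⁻ ω, ENNReal.ofReal (H (r, ω)) ∂μ :=
          lintegral_lintegral_swap (hHm.comp measurable_swap).ennreal_ofReal.aemeasurable
      _ ≤ ∫⁻ _r in Ioo a b, ENNReal.ofReal (3 * B) := by
          refine setLIntegral_mono measurable_const fun r hr => ?_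
          have hHi : Integrable (fun ω => H (r, ω)) μ := ((hi r).const_mul 2).add (hi' r)
          rw [← ofReal_integral_eq_lintegral_ofReal hHi (ae_of_all _ fun ω => hH0 (r, ω))]
          refine ENNReal.ofReal_le_ofReal ?_
          simp only [hH]
          rw [integral_add ((hi r).const_mul 2) (hi' r), integral_const_mul]
          linarith [hB r hr, hB' r hr]
      _ = _ := by
          rw [setLIntegral_const, Real.volume_Ioo, ← ENNReal.ofReal_mul (by positivity)]
          congr 1; ring
  have hIint : Integrable (fun ω => ∫ r in Ioo a b, H (r, ω)) μ := by
    refine ⟨hIm.aestronglyMeasurable, ?_⟩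
    rw [hasFiniteIntegral_iff_ofReal (ae_of_all _ hI0)]
    exact hlint.trans_lt ENNReal.ofReal_lt_top
  refine ⟨fun ω => |G x ω| ^ 3 + ∫ r in Ioo a b, H (r, ω),
    ((hG.comp measurable_prodMk_left).norm.pow_const 3).add hIm,
    fun ω => add_nonneg (by positivity) (hI0 ω),
    (hi x).add hIint, ?_, fun ω t ht => (key ω t ht).2⟩
  rw [integral_add (hi x) hIint]
  have h2 : ∫ ω, (∫ r in Ioo a b, H (r, ω)) ∂μ ≤ 3 * (b - a) * B := by
    rw [integral_eq_lintegral_of_nonneg_ae (ae_of_all _ hI0) hIm.aestronglyMeasurable]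
    exact ENNReal.toReal_le_of_le_ofReal (by positivity) hlint
  linarith [hB x hx]

/-! ### Matrix families with three derivatives -/

/-- Matrices `A k t`, where `A (k + 1)` is the derivative of `A k` on `(a, b)`, with diagonal
entries of order `1` and other entries of order `1 / n`. -/
structure IsDerivFamily {ι : Type*} [Fintype ι] (a b K : ℝ) (A : ℕ → ℝ → Matrix ι ι ℝ) :
    Prop where
  measurable : ∀ k i j, Measurable fun t => A k t i j
  hasDerivAt : ∀ k < 3, ∀ t ∈ Ioo a b, ∀ i j,
    HasDerivAt (fun t => A k t i j) (A (k + 1) t i j) t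
  diag_le : ∀ k ≤ 3, ∀ t ∈ Ioo a b, ∀ i, |A k t i i| ≤ K
  offDiag_le : ∀ k ≤ 3, ∀ t ∈ Ioo a b, ∀ i j, i ≠ j → |A k t i j| ≤ K / Fintype.card ι

namespace IsDerivFamily

variable {ι : Type*} [Fintype ι] {a b K : ℝ} {A : ℕ → ℝ → Matrix ι ι ℝ}

theorem hasDerivAt_quadOn (hA : IsDerivFamily a b K A) (s x : ι → ℝ) {k : ℕ} (hk : k < 3) {t : ℝ}
    (ht : t ∈ Ioo a b) : HasDerivAt (fun t => quadOn s (A k t) Finset.univ x)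
      (quadOn s (A (k + 1) t) Finset.univ x) t := by
  unfold quadOn
  exact (HasDerivAt.fun_sum fun i _ => HasDerivAt.fun_sum fun j _ =>
    (hA.hasDerivAt k hk t ht i j).mul_const _).sub
    (HasDerivAt.fun_sum fun i _ => (hA.hasDerivAt k hk t ht i i).mul_const _)

theorem hasDerivAt_trace (hA : IsDerivFamily a b K A) {k : ℕ} (hk : k < 3) {t : ℝ}
    (ht : t ∈ Ioo a b) : HasDerivAt (fun t => (A k t).trace) (A (k + 1) t).trace t := by
  unfold Matrix.trace
  exact HasDerivAt.fun_sum fun i _ => hA.hasDerivAt k hk t ht i i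

theorem abs_trace_le (hA : IsDerivFamily a b K A) {k : ℕ} (hk : k ≤ 3) {t : ℝ}
    (ht : t ∈ Ioo a b) : |(A k t).trace| ≤ K * Fintype.card ι := by
  refine (Finset.abs_sum_le_sum_abs _ _).trans ?_
  calc _ ≤ ∑ _i : ι, K := Finset.sum_le_sum fun i _ => hA.diag_le k hk t ht i
    _ = _ := by rw [Finset.sum_const, nsmul_eq_mul, Finset.card_univ, mul_comm]

theorem measurable_quadOn (hA : IsDerivFamily a b K A) (s : ι → ℝ) (k : ℕ) :
    Measurable fun z : ℝ × (ι → ℝ) => quadOn s (A k z.1) Finset.univ z.2 := by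
  unfold quadOn
  have h : ∀ i j, Measurable fun z : ℝ × (ι → ℝ) => A k z.1 i j := fun i j =>
    (hA.measurable k i j).comp measurable_fst
  exact (Finset.measurable_fun_sum _ fun i _ => Finset.measurable_fun_sum _ fun j _ =>
    (h i j).mul (by fun_prop)).sub
    (Finset.measurable_fun_sum _ fun i _ => (h i i).mul_const _)

theorem exists_abs_quadOn_le (hA : IsDerivFamily a b K A) (s x : ι → ℝ) {k : ℕ} (hk : k ≤ 3) :
    ∃ C, ∀ t ∈ Ioo a b, |quadOn s (A k t) Finset.univ x| ≤ C := by
  classical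
  set B := |K| + |K / Fintype.card ι|
  have hB : ∀ t ∈ Ioo a b, ∀ i j, |A k t i j| ≤ B := by
    intro t ht i j
    by_cases h : i = j
    · subst h
      exact (hA.diag_le k hk t ht i).trans ((le_abs_self _).trans
        (le_add_of_nonneg_right (abs_nonneg _)))
    · exact (hA.offDiag_le k hk t ht i j h).trans ((le_abs_self _).trans
        (le_add_of_nonneg_left (abs_nonneg _)))
  refine ⟨∑ i, ∑ j, B * |x i * x j| + ∑ i, B * |s i|, fun t ht => ?_⟩
  refine (abs_sub _ _).trans (add_le_add ?_ ?_)
  · refine (Finset.abs_sum_le_sum_abs _ _).trans (Finset.sum_le_sum fun i _ => ?_)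
    refine (Finset.abs_sum_le_sum_abs _ _).trans (Finset.sum_le_sum fun j _ => ?_)
    rw [abs_mul]
    exact mul_le_mul_of_nonneg_right (hB t ht i j) (abs_nonneg _)
  · refine (Finset.abs_sum_le_sum_abs _ _).trans (Finset.sum_le_sum fun i _ => ?_)
    rw [abs_mul]
    exact mul_le_mul_of_nonneg_right (hB t ht i i) (abs_nonneg _)

variable {Ω : Type*} [MeasurableSpace Ω] {μ : Measure Ω} [IsProbabilityMeasure μ]
  {u : ι → Ω → ℝ} {s : ι → ℝ} {M : ℝ}

/-- One variable must serve `g`, `g'` and `g''` at once, hence a sum of three dominating variables.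
Each level is controlled through the next one, which is why moments are required up to level `3`. -/
theorem exists_dominating (hA : IsDerivFamily a b K A) (hu : IsCenteredFamily μ u s M)
    {B x : ℝ} (hx : x ∈ Ioo a b)
    (hB : ∀ l ≤ 3, ∀ t ∈ Ioo a b,
      ∫ ω, |quadOn s (A l t) Finset.univ fun i => u i ω| ^ 3 ∂μ ≤ B) :
    ∃ V : Ω → ℝ, Measurable V ∧ (∀ ω, 0 ≤ V ω) ∧ Integrable V μ ∧
      ∫ ω, V ω ∂μ ≤ 3 * ((1 + 3 * (b - a)) * B) ∧
      ∀ k < 3, ∀ ω, ∀ t ∈ Ioo a b, |quadOn s (A k t) Finset.univ fun i => u i ω| ^ 3 ≤ V ω := by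
  have hpair : Measurable fun z : ℝ × Ω => (z.1, fun i => u i z.2) :=
    Measurable.prodMk measurable_fst
      (measurable_pi_lambda _ fun i => (hu.measurable i).comp measurable_snd)
  have hmeas : ∀ k, Measurable fun z : ℝ × Ω => quadOn s (A k z.1) Finset.univ fun i => u i z.2 :=
    fun k => by
      have := (hA.measurable_quadOn s k).comp hpair
      simpa only [Function.comp_def] using this
  have level := fun k (hk : k < 3) =>
    exists_dominating_of_hasDerivAt (μ := μ)
      (G := fun t ω => quadOn s (A k t) Finset.univ fun i => u i ω)
      (G' := fun t ω => quadOn s (A (k + 1) t) Finset.univ fun i => u i ω) hx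
      (hmeas k) (hmeas (k + 1))
      (fun ω t ht => hA.hasDerivAt_quadOn s _ hk ht)
      (fun ω => hA.exists_abs_quadOn_le s _ hk.le)
      (fun ω => hA.exists_abs_quadOn_le s _ (Nat.succ_le_of_lt hk))
      (fun t => (hu.memLp_quadOn (A k t) Finset.univ).integrable_abs_pow_three)
      (fun t => (hu.memLp_quadOn (A (k + 1) t) Finset.univ).integrable_abs_pow_three)
      (hB k hk.le) (hB (k + 1) (Nat.succ_le_of_lt hk))
  choose! V hVm hV0 hVi hVB hV using level
  have h0 : 0 < 3 := by norm_num
  have h1 : 1 < 3 := by norm_num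
  have h2 : 2 < 3 := by norm_num
  have i01 := (hVi 0 h0).fun_add (hVi 1 h1)
  refine ⟨fun ω => V 0 ω + V 1 ω + V 2 ω, ((hVm 0 h0).add (hVm 1 h1)).add (hVm 2 h2),
    fun ω => add_nonneg (add_nonneg (hV0 0 h0 ω) (hV0 1 h1 ω)) (hV0 2 h2 ω),
    i01.fun_add (hVi 2 h2), ?_, ?_⟩
  · rw [integral_add i01 (hVi 2 h2), integral_add (hVi 0 h0) (hVi 1 h1)]
    linarith [hVB 0 h0, hVB 1 h1, hVB 2 h2]
  · intro k hk ω t ht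
    refine (hV k hk ω t ht).trans ?_
    have a0 := hV0 0 h0 ω
    have a1 := hV0 1 h1 ω
    have a2 := hV0 2 h2 ω
    interval_cases k <;> linarith

end IsDerivFamily

/-! ### Remainders of the expansion and moments of a root -/

/-- Integration of a remainder that is controlled by `V` outside a negligible event `F`. -/
theorem abs_integral_remainder_le {Ω : Type*} [MeasurableSpace Ω] {μ : Measure Ω}
    {R V φ : Ω → ℝ} {C q : ℝ} {F : Set Ω} (hC : 0 ≤ C) (hq : 0 ≤ q) (hR : Measurable R)
    (hV : Measurable V) (hVi : Integrable V μ) (hφ : Measurable φ)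
    (hgood : ∀ ω, ω ∉ F → |R ω| ≤ C * V ω) (hall : ∀ ω, |R ω| ≤ C * (1 + φ ω ^ 2 + V ω))
    (hF : ∫⁻ ω in F, ENNReal.ofReal (1 + φ ω ^ 2) ∂μ ≤ ENNReal.ofReal q) :
    Integrable R μ ∧ |∫ ω, R ω ∂μ| ≤ C * (∫ ω, V ω ∂μ + q) := by
  -- `F` need not be measurable. It is replaced by the measurable set where the good bound fails,
  -- which is contained in `F`.
  set E : Set Ω := {ω | C * V ω < |R ω|} with hE
  have hEm : MeasurableSet E := measurableSet_lt (hV.const_mul C) hR.norm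
  have hEF : E ⊆ F := fun ω hω => by
    by_contra h
    exact absurd (hgood ω h) (not_le.2 hω)
  set h : Ω → ℝ := E.indicator fun ω => 1 + φ ω ^ 2 with hh
  have hhm : Measurable h := (measurable_const.add (hφ.pow_const 2)).indicator hEm
  have hh0 : ∀ ω, 0 ≤ h ω := fun ω => indicator_nonneg (fun ω _ => by positivity) ω
  have hlint : ∫⁻ ω, ENNReal.ofReal (h ω) ∂μ ≤ ENNReal.ofReal q := by
    calc _ = ∫⁻ ω, E.indicator (fun ω => ENNReal.ofReal (1 + φ ω ^ 2)) ω ∂μ := by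
          refine lintegral_congr fun ω => ?_
          by_cases hω : ω ∈ E <;> simp [hh, hω]
      _ = ∫⁻ ω in E, ENNReal.ofReal (1 + φ ω ^ 2) ∂μ := lintegral_indicator hEm _
      _ ≤ _ := (lintegral_mono_set hEF).trans hF
  have hhi : Integrable h μ := by
    refine ⟨hhm.aestronglyMeasurable, ?_⟩
    rw [hasFiniteIntegral_iff_ofReal (ae_of_all _ hh0)]
    exact hlint.trans_lt ENNReal.ofReal_lt_top
  have hhq : ∫ ω, h ω ∂μ ≤ q := by
    rw [integral_eq_lintegral_of_nonneg_ae (ae_of_all _ hh0) hhm.aestronglyMeasurable]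
    exact ENNReal.toReal_le_of_le_ofReal hq hlint
  have hpt : ∀ ω, ‖R ω‖ ≤ C * (V ω + h ω) := fun ω => by
    rw [Real.norm_eq_abs]
    by_cases hω : ω ∈ E
    · have : h ω = 1 + φ ω ^ 2 := by simp [hh, hω]
      rw [this, add_comm]
      exact hall ω
    · have : h ω = 0 := by simp [hh, hω]
      rw [this, add_zero]
      exact not_lt.1 hω
  have hi : Integrable (fun ω => C * (V ω + h ω)) μ := (hVi.add hhi).const_mul C
  refine ⟨hi.mono' hR.aestronglyMeasurable (ae_of_all _ hpt), ?_⟩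
  refine (norm_integral_le_of_norm_le hi (ae_of_all _ hpt)).trans ?_
  rw [integral_const_mul, integral_add hVi hhi]
  gcongr

theorem IsCenteredFamily.integral_quadOn {Ω ι : Type*} [MeasurableSpace Ω] {μ : Measure Ω}
    {u : ι → Ω → ℝ} {s : ι → ℝ} {M : ℝ} [IsProbabilityMeasure μ]
    (hu : IsCenteredFamily μ u s M) (a : Matrix ι ι ℝ) (S : Finset ι) :
    ∫ ω, (quadOn s a S fun i => u i ω) ∂μ = 0 := by
  classical
  induction S using Finset.induction_on with
  | empty => simp [quadOn]
  | insert k S hk ih =>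
    simp only [quadOn_insert hk]
    -- Orthogonality to the constant `1` says that the increment is centred.
    have h := hu.integral_mul_quadIncrement a hk (Ψ := fun _ => 1) measurable_const
      (fun _ _ _ => rfl) (integrable_const _)
      (by simpa using (hu.memLp_crossForm a S k).integrable (by norm_num))
    simp only [one_mul] at h
    rw [integral_add ((hu.memLp_quadOn a S).integrable (by norm_num))
      ((hu.memLp_quadIncrement a S k).integrable (by norm_num)), ih, h, add_zero]

/-- The remainders of the expansions of `φ - ψ` and `(φ - ψ) ^ 2` are crudely bounded, whether or
not `φ` is a root. -/
theorem remainder_crude_bound {c K ψ : ℝ} (hc : 0 < c) (hK : 0 ≤ K) : ∃ C : ℝ, 0 ≤ C ∧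
    ∀ φ s T T₁ G G₁ : ℝ, 0 ≤ s → c ≤ |T| → |T₁| ≤ K → |G| ≤ s → |G₁| ≤ s →
      |φ - ψ - (G / T + (G * G₁ / T ^ 2 - G ^ 2 * T₁ / T ^ 3))| ≤ C * (1 + φ ^ 2 + s ^ 3) ∧
      |(φ - ψ) ^ 2 - G ^ 2 / T ^ 2| ≤ C * (1 + φ ^ 2 + s ^ 3) := by
  -- The first group covers `|φ - ψ|` and `(φ - ψ)²`; the other summands cover the terms in `G`,
  -- `G₁`, `T₁`, using that `s` and `s²` are at most `1 + s³`.
  refine ⟨(2 + |ψ| + 2 * ψ ^ 2) + 1 / c + 1 / c ^ 2 + K / c ^ 3, by positivity, ?_⟩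
  intro φ s T T₁ G G₁ hs hT hT1 hg0 hg1
  set L := 1 + φ ^ 2 + s ^ 3 with hL
  have hL0 : 0 ≤ L := by positivity
  have hs3 : 0 ≤ s ^ 3 := by positivity
  have hs1 : s ≤ L := by
    nlinarith [sq_nonneg φ, sq_nonneg (s - 1), mul_nonneg hs (sq_nonneg (s - 1))]
  have hs2 : s ^ 2 ≤ L := by
    nlinarith [sq_nonneg φ, mul_nonneg hs (sq_nonneg (s - 1)), sq_nonneg (s - 1)]
  have b1 : |G / T| ≤ (1 / c) * L := by
    rw [abs_div]
    calc _ ≤ s / c := by gcongr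
      _ = (1 / c) * s := by ring
      _ ≤ _ := by gcongr
  have b2 : |G * G₁ / T ^ 2| ≤ (1 / c ^ 2) * L := by
    rw [abs_div, abs_mul, abs_pow]
    calc _ ≤ s * s / c ^ 2 := by gcongr
      _ = (1 / c ^ 2) * s ^ 2 := by ring
      _ ≤ _ := by gcongr
  have b4 : |G ^ 2 / T ^ 2| ≤ (1 / c ^ 2) * L := by
    rw [abs_div, abs_pow, abs_pow]
    calc _ ≤ s ^ 2 / c ^ 2 := by gcongr
      _ = (1 / c ^ 2) * s ^ 2 := by ring
      _ ≤ _ := by gcongr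
  have b3 : |G ^ 2 * T₁ / T ^ 3| ≤ (K / c ^ 3) * L := by
    rw [abs_div, abs_mul, abs_pow, abs_pow]
    calc _ ≤ s ^ 2 * K / c ^ 3 := by gcongr
      _ = (K / c ^ 3) * s ^ 2 := by ring
      _ ≤ _ := by gcongr
  have hψ0 := abs_nonneg ψ
  have hL1 : 1 ≤ L := by nlinarith [sq_nonneg φ]
  have b0 : |φ - ψ| ≤ (1 + |ψ|) * L := by
    have h1 := abs_sub φ ψ
    have h2 : |φ| ≤ 1 + φ ^ 2 := by
      rw [← sq_abs]; nlinarith [sq_nonneg (|φ| - 1)]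
    have h3 : |ψ| ≤ |ψ| * L := le_mul_of_one_le_right hψ0 hL1
    linarith
  have b0' : |(φ - ψ) ^ 2| ≤ (2 + 2 * ψ ^ 2) * L := by
    rw [abs_of_nonneg (sq_nonneg _)]
    have h3 : ψ ^ 2 ≤ ψ ^ 2 * L := le_mul_of_one_le_right (sq_nonneg _) hL1
    nlinarith [sq_nonneg (φ + ψ)]
  have p1 : 0 ≤ (1 / c) * L := by positivity
  have p2 : 0 ≤ (1 / c ^ 2) * L := by positivity
  have p3 : 0 ≤ (K / c ^ 3) * L := by positivity
  have p5 : 0 ≤ ψ ^ 2 * L := by positivity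
  have p6 : 0 ≤ |ψ| * L := by positivity
  have eC : ((2 + |ψ| + 2 * ψ ^ 2) + 1 / c + 1 / c ^ 2 + K / c ^ 3) * L
      = (2 + |ψ| + 2 * ψ ^ 2) * L + (1 / c) * L + (1 / c ^ 2) * L + (K / c ^ 3) * L := by ring
  constructor
  · have : |φ - ψ - (G / T + (G * G₁ / T ^ 2 - G ^ 2 * T₁ / T ^ 3))|
        ≤ |φ - ψ| + (|G / T| + (|G * G₁ / T ^ 2| + |G ^ 2 * T₁ / T ^ 3|)) := by
      refine (abs_sub _ _).trans (add_le_add le_rfl ?_)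
      exact (abs_add_le _ _).trans (add_le_add le_rfl (abs_sub _ _))
    rw [eC]
    linarith
  · have : |(φ - ψ) ^ 2 - G ^ 2 / T ^ 2| ≤ |(φ - ψ) ^ 2| + |G ^ 2 / T ^ 2| := abs_sub _ _
    rw [eC]
    linarith

/-- Expansion of a root `φ` of `g 0 t = (t - ψ) T 0 t`, when `T` is of order `n`. -/
theorem remainder_bound {a b c K ψ : ℝ} (hc : 0 < c) (hK : 0 ≤ K) (hψ : ψ ∈ Ioo a b) :
    ∃ C : ℝ, 0 ≤ C ∧ ∀ (n V : ℝ) (g T : ℕ → ℝ → ℝ) (φ : ℝ), 0 < n → 0 ≤ V →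
      (∀ k < 3, ∀ t ∈ Ioo a b, HasDerivAt (g k) (g (k + 1) t) t) →
      (∀ k < 3, ∀ t ∈ Ioo a b, HasDerivAt (T k) (T (k + 1) t) t) →
      (∀ k < 3, ∀ t ∈ Ioo a b, |g k t| ^ 3 ≤ V) → (∀ k < 3, ∀ t ∈ Ioo a b, |T k t| ≤ K * n) →
      (∀ t ∈ Ioo a b, c * n ≤ |T 0 t|) →
      (φ ∈ Ioo a b ∧ g 0 φ = (φ - ψ) * T 0 φ →
        |φ - ψ - (g 0 ψ / T 0 ψ + (g 0 ψ * g 1 ψ / T 0 ψ ^ 2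
          - g 0 ψ * g 0 ψ * T 1 ψ / T 0 ψ ^ 3))| ≤ C * (V / n ^ 3) ∧
        |(φ - ψ) ^ 2 - g 0 ψ * g 0 ψ / T 0 ψ ^ 2| ≤ C * (V / n ^ 3)) ∧
      |φ - ψ - (g 0 ψ / T 0 ψ + (g 0 ψ * g 1 ψ / T 0 ψ ^ 2
        - g 0 ψ * g 0 ψ * T 1 ψ / T 0 ψ ^ 3))| ≤ C * (1 + φ ^ 2 + V / n ^ 3) ∧
      |(φ - ψ) ^ 2 - g 0 ψ * g 0 ψ / T 0 ψ ^ 2| ≤ C * (1 + φ ^ 2 + V / n ^ 3) := by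
  obtain ⟨C₀, hC₀, hroot⟩ := root_expansion hc hK
  obtain ⟨C₁, hC₁, hcrude⟩ := remainder_crude_bound (ψ := ψ) hc hK
  refine ⟨C₀ + C₁, by positivity, ?_⟩
  intro n V g T φ hn hV hg hT hgV hTK hTc
  -- After division by `n` the traces have order `1` and the forms are at most `σ`. Thus `σ` plays
  -- the role of `s` in `root_expansion`, and `σ³ = V / n³`.
  set σ := V ^ (1 / 3 : ℝ) / n with hσ
  have hσ0 : 0 ≤ σ := div_nonneg (Real.rpow_nonneg hV _) hn.le
  have hσ3 : σ ^ 3 = V / n ^ 3 := by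
    rw [hσ, div_pow]
    congr 1
    rw [← Real.rpow_natCast, ← Real.rpow_mul hV]
    norm_num
  have hgσ : ∀ k < 3, ∀ t ∈ Ioo a b, |g k t / n| ≤ σ := by
    intro k hk t ht
    refine le_of_pow_le_pow_left₀ (n := 3) (by norm_num) hσ0 ?_
    rw [hσ3, abs_div, div_pow, abs_of_pos hn]
    exact div_le_div_of_nonneg_right (hgV k hk t ht) (by positivity)
  have hTn : ∀ t ∈ Ioo a b, c ≤ |T 0 t / n| := fun t ht => by
    rw [abs_div, abs_of_pos hn, le_div_iff₀ hn]
    exact hTc t ht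
  have hTKn : ∀ k < 3, ∀ t ∈ Ioo a b, |T k t / n| ≤ K := fun k hk t ht => by
    rw [abs_div, abs_of_pos hn, div_le_iff₀ hn]
    exact hTK k hk t ht
  have hdg : ∀ k < 3, ∀ t ∈ Ioo a b, HasDerivAt (fun t => g k t / n) (g (k + 1) t / n) t :=
    fun k hk t ht => (hg k hk t ht).div_const _
  have hdT : ∀ k < 3, ∀ t ∈ Ioo a b, HasDerivAt (fun t => T k t / n) (T (k + 1) t / n) t :=
    fun k hk t ht => (hT k hk t ht).div_const _
  have h0 : 0 < 3 := by norm_num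
  have h1 : 1 < 3 := by norm_num
  have h2 : 2 < 3 := by norm_num
  have hT0 : T 0 ψ ≠ 0 := by
    intro h
    have := hTn ψ hψ
    rw [h, zero_div, abs_zero] at this
    linarith
  have e₁ : g 0 ψ / T 0 ψ + (g 0 ψ * g 1 ψ / T 0 ψ ^ 2 - g 0 ψ * g 0 ψ * T 1 ψ / T 0 ψ ^ 3)
      = (g 0 ψ / n) / (T 0 ψ / n) + ((g 0 ψ / n) * (g 1 ψ / n) / (T 0 ψ / n) ^ 2
        - (g 0 ψ / n) ^ 2 * (T 1 ψ / n) / (T 0 ψ / n) ^ 3) := by field_simp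
  have e₂ : g 0 ψ * g 0 ψ / T 0 ψ ^ 2 = (g 0 ψ / n) ^ 2 / (T 0 ψ / n) ^ 2 := by field_simp
  rw [e₁, e₂, ← hσ3]
  constructor
  · rintro ⟨hin, hsol⟩
    have h := hroot (φ - ψ) σ (T 0 φ / n) (T 0 ψ / n) (T 1 ψ / n) (g 0 φ / n)
      (g 0 ψ / n) (g 1 ψ / n) hσ0 (by rw [hsol]; ring)
      (hTn _ hin) (hTn _ hψ) (hTKn 1 h1 _ hψ) (hgσ 0 h0 _ hin)
      (hgσ 0 h0 _ hψ) (hgσ 1 h1 _ hψ)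
      (abs_sub_le_mul (hdT 0 h0) (hTKn 1 h1) hψ hin)
      (abs_sub_le_mul (hdg 0 h0) (hgσ 1 h1) hψ hin)
      (abs_sub_sub_mul_le (hdT 0 h0) (hdT 1 h1) (hTKn 2 h2) hψ hin)
      (abs_sub_sub_mul_le (hdg 0 h0) (hdg 1 h1) (hgσ 2 h2) hψ hin)
    have hle : C₀ * σ ^ 3 ≤ (C₀ + C₁) * σ ^ 3 := by
      gcongr; exact le_add_of_nonneg_right hC₁
    exact ⟨h.1.trans hle, h.2.trans hle⟩
  · have h := hcrude φ σ (T 0 ψ / n) (T 1 ψ / n) (g 0 ψ / n) (g 1 ψ / n) hσ0 (hTn _ hψ)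
      (hTKn 1 h1 _ hψ) (hgσ 0 h0 _ hψ) (hgσ 1 h1 _ hψ)
    have hle : C₁ * (1 + φ ^ 2 + σ ^ 3) ≤ (C₀ + C₁) * (1 + φ ^ 2 + σ ^ 3) := by
      gcongr; exact le_add_of_nonneg_left hC₀
    exact ⟨h.1.trans hle, h.2.trans hle⟩

universe v

/-- Moments of a root `φ` of the estimating equation, in terms of those of the quadratic forms. -/
theorem root_moments {a b c K M Q ψ : ℝ} (hc : 0 < c) (hK : 0 ≤ K) (hM : 0 ≤ M) (hQ : 0 ≤ Q)
    (hψ : ψ ∈ Ioo a b) : ∃ C : ℝ, 0 ≤ C ∧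
    ∀ {Ω : Type v} [MeasurableSpace Ω] (μ : Measure Ω) [IsProbabilityMeasure μ] (n : ℕ)
      (u : Fin n → Ω → ℝ) (s : Fin n → ℝ) (A : ℕ → ℝ → Matrix (Fin n) (Fin n) ℝ) (φ : Ω → ℝ)
      (F : Set Ω), 0 < n → IsCenteredFamily μ u s M → IsDerivFamily a b K A →
      (∀ t ∈ Ioo a b, c * n ≤ |(A 0 t).trace|) → Measurable φ →
      (∀ ω, ω ∉ F → φ ω ∈ Ioo a b ∧ (quadOn s (A 0 (φ ω)) Finset.univ fun i => u i ω)
        = (φ ω - ψ) * (A 0 (φ ω)).trace) →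
      ∫⁻ ω in F, ENNReal.ofReal (1 + φ ω ^ 2) ∂μ ≤ ENNReal.ofReal (Q / √n ^ 3) →
      MemLp φ 2 μ ∧
      |∫ ω, (φ ω - ψ) ∂μ
        - ((∫ ω, (quadOn s (A 0 ψ) Finset.univ fun i => u i ω)
            * (quadOn s (A 1 ψ) Finset.univ fun i => u i ω) ∂μ) / (A 0 ψ).trace ^ 2
          - (∫ ω, (quadOn s (A 0 ψ) Finset.univ fun i => u i ω)
            * (quadOn s (A 0 ψ) Finset.univ fun i => u i ω) ∂μ) * (A 1 ψ).trace
              / (A 0 ψ).trace ^ 3)| ≤ C / √n ^ 3 ∧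
      |∫ ω, (φ ω - ψ) ^ 2 ∂μ
        - (∫ ω, (quadOn s (A 0 ψ) Finset.univ fun i => u i ω)
            * (quadOn s (A 0 ψ) Finset.univ fun i => u i ω) ∂μ) / (A 0 ψ).trace ^ 2|
        ≤ C / √n ^ 3 := by
  obtain ⟨C₂, hC₂0, hrem⟩ := remainder_bound hc hK hψ
  set Z := 9 * ((16 * (M + (1 + M) ^ 3) + 64 * M) * K ^ 3) with hZ
  have hZ0 : 0 ≤ Z := by positivity
  have hab : 0 ≤ b - a := by linarith [hψ.1, hψ.2]
  -- The dominating variable has mean at most `C₁ r³` with `r = √n`, so `V / n³` has mean at most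
  -- `C₁ / r³`.
  set C₁ := 3 * ((1 + 3 * (b - a)) * Z) with hC₁
  have hC₁0 : 0 ≤ C₁ := by positivity
  refine ⟨C₂ * (C₁ + Q), by positivity, ?_⟩
  intro Ω _ μ _ n u s A φ F hn hu hA hT hφ hF hFq
  have hn1 : (1 : ℝ) ≤ n := by exact_mod_cast hn
  have hn0 : (0 : ℝ) < n := by linarith
  have hr2 : √(n : ℝ) ^ 2 = n := Real.sq_sqrt (by positivity)
  have hr0 : 0 < √(n : ℝ) := Real.sqrt_pos.2 hn0
  set r := √(n : ℝ)
  obtain ⟨V, hVm, hV0, hVi, hVint, hVdom⟩ := hA.exists_dominating hu hψ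
    (B := Z * r ^ 3) (fun l hl t ht => by
      have := hu.integral_abs_quadOn_pow_three_le hM hK (hA.diag_le l hl t ht)
        (hA.offDiag_le l hl t ht)
      simpa only [Fintype.card_fin] using this)
  have hTK : ∀ k < 3, ∀ t ∈ Ioo a b, |(A k t).trace| ≤ K * n := fun k hk t ht => by
    have := hA.abs_trace_le hk.le ht
    rwa [Fintype.card_fin] at this
  have hrem' := fun ω => hrem n (V ω) (fun k t => quadOn s (A k t) Finset.univ fun i => u i ω)
    (fun k t => (A k t).trace) (φ ω) hn0 (hV0 ω) (fun k hk t ht => hA.hasDerivAt_quadOn s _ hk ht)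
    (fun k hk t ht => hA.hasDerivAt_trace hk ht) (fun k hk t ht => hVdom k hk ω t ht) hTK hT
  have hGL : ∀ k, MemLp (fun ω => quadOn s (A k ψ) Finset.univ fun i => u i ω) 3 μ :=
    fun k => hu.memLp_quadOn (A k ψ) Finset.univ
  have hGm : ∀ k, Measurable fun ω => quadOn s (A k ψ) Finset.univ fun i => u i ω := fun k => by
    have := (FayHerriot.measurable_quadOn (s := s) (a := A k ψ) (S := Finset.univ)).comp
      (measurable_pi_lambda _ hu.measurable)
    simpa only [Function.comp_def] using this
  have hG0 := hu.integral_quadOn (A 0 ψ) Finset.univ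
  replace hrem' := fun ω => And.intro (fun h : ω ∉ F => (hrem' ω).1 (hF ω h)) (hrem' ω).2
  replace hF := fun ω hω => (hF ω hω).1
  have hGL0 := hGL 0
  have hGL1 := hGL 1
  have hGm0 := hGm 0
  have hGm1 := hGm 1
  clear hGL hGm
  obtain ⟨G₀, hG₀⟩ : ∃ G₀ : Ω → ℝ, ∀ ω, (quadOn s (A 0 ψ) Finset.univ fun i => u i ω) = G₀ ω :=
    ⟨_, fun _ => rfl⟩
  obtain ⟨G₁, hG₁⟩ : ∃ G₁ : Ω → ℝ, ∀ ω, (quadOn s (A 1 ψ) Finset.univ fun i => u i ω) = G₁ ω :=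
    ⟨_, fun _ => rfl⟩
  simp only [hG₀, hG₁] at *
  generalize (A 0 ψ).trace = T at *
  generalize (A 1 ψ).trace = T₁ at *
  set R₁ : Ω → ℝ := fun ω => φ ω - ψ
    - (G₀ ω / T + (G₀ ω * G₁ ω / T ^ 2 - G₀ ω * G₀ ω * T₁ / T ^ 3)) with hR₁
  set R₂ : Ω → ℝ := fun ω => (φ ω - ψ) ^ 2 - G₀ ω * G₀ ω / T ^ 2 with hR₂
  have hσm : Measurable fun ω => V ω / (n : ℝ) ^ 3 := hVm.div_const _
  have hσi : Integrable (fun ω => V ω / (n : ℝ) ^ 3) μ := hVi.div_const _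
  have hσint : ∫ ω, V ω / (n : ℝ) ^ 3 ∂μ ≤ C₁ / r ^ 3 := by
    rw [integral_div]
    calc _ ≤ 3 * ((1 + 3 * (b - a)) * (Z * r ^ 3)) / (n : ℝ) ^ 3 := by gcongr
      _ = C₁ / r ^ 3 := by rw [hC₁, ← hr2]; field_simp
  have hq : 0 ≤ Q / r ^ 3 := by positivity
  have hR₁m : Measurable R₁ := by fun_prop
  have hR₂m : Measurable R₂ := by fun_prop
  obtain ⟨hR₁i, hR₁b⟩ := abs_integral_remainder_le hC₂0 hq hR₁m hσm hσi hφ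
    (fun ω hω => ((hrem' ω).1 hω).1) (fun ω => (hrem' ω).2.1) hFq
  obtain ⟨hR₂i, hR₂b⟩ := abs_integral_remainder_le hC₂0 hq hR₂m hσm hσi hφ
    (fun ω hω => ((hrem' ω).1 hω).2) (fun ω => (hrem' ω).2.2) hFq
  have hbound : C₂ * (∫ ω, V ω / (n : ℝ) ^ 3 ∂μ + Q / r ^ 3) ≤ C₂ * (C₁ + Q) / r ^ 3 := by
    calc _ ≤ C₂ * (C₁ / r ^ 3 + Q / r ^ 3) := by gcongr
      _ = _ := by ring
  -- Second moment of `φ` from the same lemma, with `R = φ²` and `V = 1`: off `F` the value lies in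
  -- `(a, b)`, so `φ² ≤ a² + b²`.
  have hφ2 := (abs_integral_remainder_le (μ := μ) (R := fun ω => φ ω ^ 2) (V := fun _ => 1)
    (φ := φ) (C := 1 + a ^ 2 + b ^ 2) (F := F) (by positivity) hq (hφ.pow_const 2)
    measurable_const (integrable_const _) hφ
    (fun ω hω => by
      have h := hF ω hω
      rw [abs_of_nonneg (sq_nonneg _)]
      rcases le_total 0 (φ ω) with h0 | h0
      · nlinarith [h.1, h.2, sq_nonneg a]
      · nlinarith [h.1, h.2, sq_nonneg b])
    (fun ω => by
      rw [abs_of_nonneg (sq_nonneg _)]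
      nlinarith [sq_nonneg (φ ω), sq_nonneg a, sq_nonneg b,
        mul_nonneg (sq_nonneg a) (sq_nonneg (φ ω)), mul_nonneg (sq_nonneg b) (sq_nonneg (φ ω))])
    hFq).1
  have hφL : MemLp φ 2 μ := (memLp_two_iff_integrable_sq hφ.aestronglyMeasurable).2 hφ2
  have hδL : MemLp (fun ω => φ ω - ψ) 2 μ := hφL.sub (memLp_const ψ)
  have i0 : Integrable (fun ω => G₀ ω / T) μ := (hGL0.integrable (by norm_num)).div_const _
  have i1 : Integrable (fun ω => G₀ ω * G₁ ω / T ^ 2) μ :=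
    (integrable_mul_of_memLp_three hGL0 hGL1).div_const _
  have i00 := integrable_mul_of_memLp_three hGL0 hGL0
  have i2 : Integrable (fun ω => G₀ ω * G₀ ω * T₁ / T ^ 3) μ := (i00.mul_const _).div_const _
  have i3 : Integrable (fun ω => G₀ ω * G₀ ω / T ^ 2) μ := i00.div_const _
  refine ⟨hφL, ?_, ?_⟩
  · refine le_trans (le_of_eq ?_) (hR₁b.trans hbound)
    congr 1
    simp only [hR₁]
    have i12 : Integrable (fun ω => G₀ ω * G₁ ω / T ^ 2 - G₀ ω * G₀ ω * T₁ / T ^ 3) μ :=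
      i1.sub i2
    rw [integral_sub (hδL.integrable (by norm_num)) (i0.fun_add i12), integral_add i0 i12, integral_sub i1 i2,
      integral_div, integral_div,
      integral_div, integral_mul_const, hG0, zero_div, zero_add]
  · refine le_trans (le_of_eq ?_) (hR₂b.trans hbound)
    congr 1
    simp only [hR₂]
    rw [integral_sub hδL.integrable_sq i3, integral_div]

/-- Bias and variance of a root of the estimating equation, for a weight matrix that is diagonal up
to a perturbation of order `1 / n`. -/
theorem root_bias_variance {a b c K M Q ψ : ℝ} (hc : 0 < c) (hK : 0 ≤ K) (hM : 0 ≤ M) (hQ : 0 ≤ Q)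
    (hψ : ψ ∈ Ioo a b) : ∃ C : ℝ, 0 ≤ C ∧
    ∀ {Ω : Type v} [MeasurableSpace Ω] (μ : Measure Ω) [IsProbabilityMeasure μ] (n : ℕ)
      (u : Fin n → Ω → ℝ) (s : Fin n → ℝ) (A : ℕ → ℝ → Matrix (Fin n) (Fin n) ℝ) (φ : Ω → ℝ)
      (F : Set Ω) (w w₁ : Fin n → ℝ) (P P₁ : Matrix (Fin n) (Fin n) ℝ),
      0 < n → IsCenteredFamily μ u s M → IsDerivFamily a b K A →
      (∀ t ∈ Ioo a b, c * n ≤ |(A 0 t).trace|) → Measurable φ →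
      (∀ ω, ω ∉ F → φ ω ∈ Ioo a b ∧ (quadOn s (A 0 (φ ω)) Finset.univ fun i => u i ω)
        = (φ ω - ψ) * (A 0 (φ ω)).trace) →
      ∫⁻ ω in F, ENNReal.ofReal (1 + φ ω ^ 2) ∂μ ≤ ENNReal.ofReal (Q / √n ^ 3) →
      A 0 ψ = diagonal w + P → A 1 ψ = diagonal w₁ + P₁ →
      (∀ i, |w i| ≤ K) → (∀ i, |w₁ i| ≤ K) → (∀ i j, |P i j| ≤ K / n) →
      (∀ i j, |P₁ i j| ≤ K / n) → c * n ≤ |∑ i, w i| →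
      MemLp φ 2 μ ∧
      |∫ ω, (φ ω - ψ) ∂μ
        - ((∑ i, w i * w₁ i * ∫ ω, (u i ω ^ 2 - s i) ^ 2 ∂μ) / (∑ i, w i) ^ 2
          - (∑ i, w i * w i * ∫ ω, (u i ω ^ 2 - s i) ^ 2 ∂μ) * (∑ i, w₁ i)
              / (∑ i, w i) ^ 3)| ≤ C / √n ^ 3 ∧
      |variance φ μ - (∑ i, w i * w i * ∫ ω, (u i ω ^ 2 - s i) ^ 2 ∂μ) / (∑ i, w i) ^ 2|
        ≤ C / √n ^ 3 := by
  obtain ⟨C₀, hC₀, hmom⟩ := root_moments.{v} hc hK hM hQ hψ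
  -- `K'` bounds the sums of covariances and the traces after division by `n`.
  set K' := (1 + M) * K ^ 2 + K with hK'
  have hK'0 : 0 ≤ K' := by positivity
  obtain ⟨C₁, hC₁, hstab⟩ := leading_terms_stable hc hK'0
  -- `E / √n` bounds the effect of the perturbation on the normalised ingredients: the first summand
  -- for the covariances, the extra `K` for the traces.
  set E := (2 * (1 + M) + 4 * (2 * (1 + M) + 8 * (1 + M) ^ 2)) * K ^ 2 + K with hE
  have hE0 : 0 ≤ E := by positivity
  set C₂ := C₀ + C₁ * E with hC₂
  have hC₂0 : 0 ≤ C₂ := by positivity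
  set C₃ := C₂ + (K' / c ^ 2 + K' * K' / c ^ 3) with hC₃
  have hC₃0 : 0 ≤ C₃ := by positivity
  -- `C₂` handles the bias and the second moment about `ψ`; `C₃ / n` bounds the mean of `φ - ψ`,
  -- whose square separates that second moment from the variance.
  refine ⟨C₂ + C₃ ^ 2, by positivity, ?_⟩
  intro Ω _ μ _ n u s A φ F w w₁ P P₁ hn hu hA hT hφ hF hFq hA0 hA1 hw hw₁ hP hP₁ hτ
  obtain ⟨hφL, hbias, hsq⟩ := hmom μ n u s A φ F hn hu hA hT hφ hF hFq
  have hn1 : (1 : ℝ) ≤ n := by exact_mod_cast hn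
  have hn0 : (0 : ℝ) < n := by linarith
  have hr2 : √(n : ℝ) ^ 2 = n := Real.sq_sqrt (by positivity)
  have hr1 : 1 ≤ √(n : ℝ) := Real.one_le_sqrt.2 hn1
  have hcov : ∀ {w w' : Fin n → ℝ} {P P' : Matrix (Fin n) (Fin n) ℝ}, (∀ i, |w i| ≤ K) →
      (∀ i, |w' i| ≤ K) → (∀ i j, |P i j| ≤ K / n) → (∀ i j, |P' i j| ≤ K / n) →
      |(∫ ω, (quadOn s (diagonal w + P) Finset.univ fun i => u i ω)
        * (quadOn s (diagonal w' + P') Finset.univ fun i => u i ω) ∂μ) / n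
      - (∑ i, w i * w' i * ∫ ω, (u i ω ^ 2 - s i) ^ 2 ∂μ) / n| ≤ E / √n := by
    intro w w' P P' h1 h2 h3 h4
    have h := hu.abs_integral_quadOn_mul_sub_le hM (by simpa using hn) h1 h2
      (by simpa using h3) (by simpa using h4)
    rw [Fintype.card_fin] at h
    rw [← sub_div, abs_div, abs_of_pos hn0, div_le_div_iff₀ hn0 (by linarith)]
    calc _ ≤ (2 * (1 + M) + 4 * (2 * (1 + M) + 8 * (1 + M) ^ 2)) * K ^ 2 * √n * √n := by gcongr
      _ = (2 * (1 + M) + 4 * (2 * (1 + M) + 8 * (1 + M) ^ 2)) * K ^ 2 * n := by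
          rw [mul_assoc, ← pow_two, hr2]
      _ ≤ E * n := by
          rw [hE]
          gcongr
          linarith
  have hsum : ∀ {w w' : Fin n → ℝ}, (∀ i, |w i| ≤ K) → (∀ i, |w' i| ≤ K) →
      |(∑ i, w i * w' i * ∫ ω, (u i ω ^ 2 - s i) ^ 2 ∂μ) / n| ≤ K' := by
    intro w w' h1 h2
    have h := hu.abs_sum_mul_le h1 h2
    rw [Fintype.card_fin] at h
    rw [abs_div, abs_of_pos hn0, div_le_iff₀ hn0]
    refine h.trans ?_
    rw [hK']
    gcongr
    linarith
  have htr : ∀ {w : Fin n → ℝ} {P : Matrix (Fin n) (Fin n) ℝ}, (∀ i j, |P i j| ≤ K / n) →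
      |(diagonal w + P).trace / n - (∑ i, w i) / n| ≤ E / √n := by
    intro w P h
    rw [trace_add, trace_diagonal, add_div, add_sub_cancel_left, abs_div, abs_of_pos hn0]
    have hb : |P.trace| ≤ K := by
      refine (Finset.abs_sum_le_sum_abs _ _).trans ?_
      calc _ ≤ ∑ _i : Fin n, K / n := Finset.sum_le_sum fun i _ => h i i
        _ = K := by
            rw [Finset.sum_const, nsmul_eq_mul, Finset.card_univ, Fintype.card_fin]
            field_simp
    calc |P.trace| / n ≤ K / n := by gcongr
      _ ≤ E / √n := by
          have h1 : √(n : ℝ) ≤ n := by nlinarith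
          refine div_le_div₀ hE0 ?_ (by linarith) h1
          rw [hE]
          exact le_add_of_nonneg_left (by positivity)
  have hwn : ∀ {w : Fin n → ℝ}, (∀ i, |w i| ≤ K) → |(∑ i, w i) / n| ≤ K' := by
    intro w h
    rw [abs_div, abs_of_pos hn0, div_le_iff₀ hn0]
    refine (Finset.abs_sum_le_sum_abs _ _).trans ?_
    calc _ ≤ ∑ _i : Fin n, K := Finset.sum_le_sum fun i _ => h i
      _ = K * n := by
          rw [Finset.sum_const, nsmul_eq_mul, Finset.card_univ, Fintype.card_fin, mul_comm]
      _ ≤ K' * n := by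
          rw [hK']
          gcongr
          exact le_add_of_nonneg_left (by positivity)
  have hT1n : |(A 1 ψ).trace / n| ≤ K' := by
    rw [abs_div, abs_of_pos hn0, div_le_iff₀ hn0]
    have := hA.abs_trace_le (k := 1) (by norm_num) hψ
    rw [Fintype.card_fin] at this
    refine this.trans ?_
    rw [hK']
    gcongr
    exact le_add_of_nonneg_left (by positivity)
  have hTn : c ≤ |(A 0 ψ).trace / n| := by
    rw [abs_div, abs_of_pos hn0, le_div_iff₀ hn0]; exact hT ψ hψ
  have hτn : c ≤ |(∑ i, w i) / n| := by
    rw [abs_div, abs_of_pos hn0, le_div_iff₀ hn0]; exact hτ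
  have hx := hcov hw hw₁ hP hP₁
  have hy := hcov hw hw hP hP
  rw [← hA0, ← hA1] at hx
  rw [← hA0] at hy
  have ht0 := htr (w := w) hP
  have ht1 := htr (w := w₁) hP₁
  rw [← hA0] at ht0
  rw [← hA1] at ht1
  have hx0 := hsum hw hw₁
  have hy0 := hsum hw hw
  have hτ1 := hwn hw₁
  generalize (∫ ω, (quadOn s (A 0 ψ) Finset.univ fun i => u i ω)
    * (quadOn s (A 1 ψ) Finset.univ fun i => u i ω) ∂μ) = x at *
  generalize (∫ ω, (quadOn s (A 0 ψ) Finset.univ fun i => u i ω)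
    * (quadOn s (A 0 ψ) Finset.univ fun i => u i ω) ∂μ) = y at *
  generalize (∑ i, w i * w₁ i * ∫ ω, (u i ω ^ 2 - s i) ^ 2 ∂μ) = x₀ at *
  generalize (∑ i, w i * w i * ∫ ω, (u i ω ^ 2 - s i) ^ 2 ∂μ) = y₀ at *
  generalize (A 0 ψ).trace = T at *
  generalize (A 1 ψ).trace = T₁ at *
  generalize (∑ i, w i) = τ at *
  generalize (∑ i, w₁ i) = τ₁ at *
  obtain ⟨hst1, hst2⟩ := hstab (E / √n) (x / n) (x₀ / n) (y / n) (y₀ / n) (T / n) (τ / n)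
    (T₁ / n) (τ₁ / n) hTn hτn hx0 hy0 hT1n hτ1 hx hy ht0 ht1
  -- Both ratios are homogeneous of degree `-1`, so normalising every ingredient by `n` pulls out
  -- `1/n`. Together with the stability error `E / √n` this is the rate `n^(-3/2)`.
  have e1 : ∀ y T : ℝ, y / T ^ 2 = (1 / n) * ((y / n) / (T / n) ^ 2) := fun y T => by field_simp
  have e2 : ∀ y T₁ T : ℝ, y * T₁ / T ^ 3 = (1 / n) * ((y / n) * (T₁ / n) / (T / n) ^ 3) :=
    fun y T₁ T => by field_simp
  set r := √(n : ℝ)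
  have hr0 : 0 < r := by linarith
  have hscale : (1 / (n : ℝ)) * (C₁ * (E / r)) = C₁ * E / r ^ 3 := by
    rw [← hr2]; field_simp
  have d1 : |y / T ^ 2 - y₀ / τ ^ 2| ≤ C₁ * E / r ^ 3 := by
    rw [e1 y, e1 y₀, ← mul_sub, abs_mul, abs_of_pos (by positivity : 0 < 1 / (n : ℝ)), ← hscale]
    gcongr
  have d2 : |(x / T ^ 2 - y * T₁ / T ^ 3) - (x₀ / τ ^ 2 - y₀ * τ₁ / τ ^ 3)| ≤ C₁ * E / r ^ 3 := by
    rw [e1 x, e1 x₀, e2 y T₁ T, e2 y₀ τ₁ τ, ← mul_sub, ← mul_sub, ← mul_sub, abs_mul,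
      abs_of_pos (by positivity : 0 < 1 / (n : ℝ)), ← hscale]
    gcongr
  have hbias' : |∫ ω, (φ ω - ψ) ∂μ - (x₀ / τ ^ 2 - y₀ * τ₁ / τ ^ 3)| ≤ C₂ / r ^ 3 := by
    refine (abs_sub_le _ _ _).trans ((add_le_add hbias d2).trans (le_of_eq ?_))
    rw [hC₂]; ring
  have hsq' : |∫ ω, (φ ω - ψ) ^ 2 ∂μ - y₀ / τ ^ 2| ≤ C₂ / r ^ 3 := by
    refine (abs_sub_le _ _ _).trans ((add_le_add hsq d1).trans (le_of_eq ?_))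
    rw [hC₂]; ring
  have hr32 : 1 / r ^ 3 ≤ 1 / n := by
    rw [← hr2]
    exact one_div_le_one_div_of_le (by positivity) (pow_le_pow_right₀ hr1 (by norm_num))
  have hmean : |∫ ω, (φ ω - ψ) ∂μ| ≤ C₃ / n := by
    have h1 : |x₀ / τ ^ 2 - y₀ * τ₁ / τ ^ 3| ≤ (1 / n) * (K' / c ^ 2 + K' * K' / c ^ 3) := by
      rw [e1, e2, ← mul_sub, abs_mul, abs_of_pos (by positivity : 0 < 1 / (n : ℝ))]
      refine mul_le_mul_of_nonneg_left ((abs_sub _ _).trans (add_le_add ?_ ?_)) (by positivity)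
      · rw [abs_div, abs_pow]; gcongr
      · rw [abs_div, abs_pow, abs_mul]; gcongr
    have h2 : C₂ / r ^ 3 ≤ C₂ * (1 / n) := by
      rw [div_eq_mul_one_div]; gcongr
    have h3 := abs_sub_abs_le_abs_sub (∫ ω, (φ ω - ψ) ∂μ) (x₀ / τ ^ 2 - y₀ * τ₁ / τ ^ 3)
    have h4 : C₃ / n = C₂ * (1 / n) + (1 / n) * (K' / c ^ 2 + K' * K' / c ^ 3) := by
      rw [hC₃]; ring
    rw [h4]
    linarith
  have hmean2 : (∫ ω, (φ ω - ψ) ∂μ) ^ 2 ≤ C₃ ^ 2 / r ^ 3 := by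
    rw [← sq_abs]
    calc _ ≤ (C₃ / n) ^ 2 := by gcongr
      _ = C₃ ^ 2 / r ^ 4 := by rw [div_pow, ← hr2]; ring
      _ ≤ C₃ ^ 2 / r ^ 3 := by
          have := pow_le_pow_right₀ hr1 (show 3 ≤ 4 by norm_num)
          gcongr
  have hle : C₂ / r ^ 3 ≤ (C₂ + C₃ ^ 2) / r ^ 3 := by
    gcongr; exact le_add_of_nonneg_right (sq_nonneg _)
  refine ⟨hφL, hbias'.trans hle, ?_⟩
  have hδL : MemLp (fun ω => φ ω - ψ) 2 μ := hφL.sub (memLp_const ψ)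
  have hvar : variance φ μ = ∫ ω, (φ ω - ψ) ^ 2 ∂μ - (∫ ω, (φ ω - ψ) ∂μ) ^ 2 := by
    rw [← variance_sub_const hφ.aestronglyMeasurable ψ, variance_eq_sub hδL]
    rfl
  rw [hvar, sub_right_comm]
  refine (abs_sub _ _).trans ?_
  rw [abs_of_nonneg (sq_nonneg (∫ ω, (φ ω - ψ) ∂μ)), add_div]
  exact add_le_add hsq' hmean2

/-! ### Calculus of functions with bounded derivatives -/

namespace BoundedC3

variable {a b B B' : ℝ} {f g : ℝ → ℝ}

theorem contDiffAt (hf : BoundedC3 a b B f) {t : ℝ} (ht : t ∈ Ioo a b) : ContDiffAt ℝ 3 f t :=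
  (hf.1 t ht).contDiffAt (isOpen_Ioo.mem_nhds ht)

theorem mono (hf : BoundedC3 a b B f) (h : B ≤ B') : BoundedC3 a b B' f :=
  ⟨hf.1, fun k hk t ht => (hf.2 k hk t ht).trans h⟩

theorem congr (hf : BoundedC3 a b B f) (h : ∀ t ∈ Ioo a b, g t = f t) : BoundedC3 a b B g := by
  refine ⟨hf.1.congr h, fun k hk t ht => ?_⟩
  have : g =ᶠ[nhds t] f := Filter.eventuallyEq_of_mem (isOpen_Ioo.mem_nhds ht) h
  rw [this.iteratedDeriv_eq k]
  exact hf.2 k hk t ht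

theorem neg (hf : BoundedC3 a b B f) : BoundedC3 a b B (fun t => -f t) := by
  refine ⟨hf.1.neg, fun k hk t ht => ?_⟩
  rw [iteratedDeriv_fun_neg, abs_neg]
  exact hf.2 k hk t ht

theorem sum {ι : Type*} {S : Finset ι} {f : ι → ℝ → ℝ} (hf : ∀ i ∈ S, BoundedC3 a b B (f i)) :
    BoundedC3 a b (S.card * B) (fun t => ∑ i ∈ S, f i t) := by
  refine ⟨ContDiffOn.sum fun i hi => (hf i hi).1, fun k hk t ht => ?_⟩
  have hk' : (k : WithTop ℕ∞) ≤ 3 := by exact_mod_cast hk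
  rw [iteratedDeriv_fun_sum fun i hi => ((hf i hi).contDiffAt ht).of_le hk']
  refine (Finset.abs_sum_le_sum_abs _ _).trans ?_
  rw [← nsmul_eq_mul, ← Finset.sum_const]
  exact Finset.sum_le_sum fun i hi => (hf i hi).2 k hk t ht

theorem add (hf : BoundedC3 a b B f) (hg : BoundedC3 a b B' g) :
    BoundedC3 a b (B + B') (fun t => f t + g t) := by
  refine ⟨hf.1.add hg.1, fun k hk t ht => ?_⟩
  have hk' : (k : WithTop ℕ∞) ≤ 3 := by exact_mod_cast hk
  have := iteratedDeriv_add ((hf.contDiffAt ht).of_le hk') ((hg.contDiffAt ht).of_le hk')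
  rw [show (fun t => f t + g t) = f + g from rfl, this]
  exact (abs_add_le _ _).trans (add_le_add (hf.2 k hk t ht) (hg.2 k hk t ht))

/-- Leibniz' rule: the binomial coefficients sum to `2 ^ k ≤ 8` for `k ≤ 3`. -/
theorem mul (hf : BoundedC3 a b B f) (hg : BoundedC3 a b B' g) :
    BoundedC3 a b (8 * (B * B')) (fun t => f t * g t) := by
  refine ⟨hf.1.mul hg.1, fun k hk t ht => ?_⟩
  have hk' : (k : WithTop ℕ∞) ≤ 3 := by exact_mod_cast hk
  have := iteratedDeriv_mul ((hf.contDiffAt ht).of_le hk') ((hg.contDiffAt ht).of_le hk')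
  have hB : 0 ≤ B := (abs_nonneg _).trans (hf.2 0 (by norm_num) t ht)
  have hB' : 0 ≤ B' := (abs_nonneg _).trans (hg.2 0 (by norm_num) t ht)
  rw [show (fun t => f t * g t) = f * g from rfl, this]
  refine (Finset.abs_sum_le_sum_abs _ _).trans ?_
  calc _ ≤ ∑ i ∈ Finset.range (k + 1), (k.choose i : ℝ) * (B * B') := by
        refine Finset.sum_le_sum fun i hi => ?_
        have hi' : i ≤ k := Nat.lt_succ_iff.1 (Finset.mem_range.1 hi)
        rw [abs_mul, abs_mul, Nat.abs_cast, mul_assoc]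
        have h1 := hf.2 i (hi'.trans hk) t ht
        have h2 := hg.2 (k - i) ((Nat.sub_le _ _).trans hk) t ht
        gcongr
    _ = 2 ^ k * (B * B') := by
        rw [← Finset.sum_mul]
        congr 1
        exact_mod_cast Nat.sum_range_choose k
    _ ≤ 8 * (B * B') := by
        have : (2 : ℝ) ^ k ≤ 2 ^ 3 := pow_le_pow_right₀ (by norm_num) hk
        gcongr
        linarith

end BoundedC3

/-- The `k`-th derivative of `f` on `(a, b)`, extended by zero. -/
noncomputable def derivOn (a b : ℝ) (f : ℝ → ℝ) (k : ℕ) (t : ℝ) : ℝ :=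
  (Ioo a b).indicator (iteratedDeriv k f) t

section DerivOn

variable {a b B : ℝ} {f : ℝ → ℝ}

theorem derivOn_of_mem {k : ℕ} {t : ℝ} (ht : t ∈ Ioo a b) :
    derivOn a b f k t = iteratedDeriv k f t := indicator_of_mem ht _

/-- Nothing is known about `f` outside `(a, b)`, while Tonelli needs measurability in `t` on the
whole line; hence the extension by zero. Only `k = 0` uses the regularity of `f`, as `deriv` is
always measurable. -/
theorem BoundedC3.measurable_derivOn (hf : BoundedC3 a b B f) (k : ℕ) :
    Measurable (derivOn a b f k) := by
  classical
  cases k with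
  | zero =>
    have : derivOn a b f 0 = (Ioo a b).piecewise f 0 := by
      funext t
      simp [derivOn, indicator, piecewise]
    rw [this]
    exact hf.1.continuousOn.measurable_piecewise continuousOn_const measurableSet_Ioo
  | succ k =>
    have : Measurable (iteratedDeriv (k + 1) f) := by
      rw [iteratedDeriv_succ]; exact measurable_deriv _
    exact this.indicator measurableSet_Ioo

theorem BoundedC3.hasDerivAt_derivOn (hf : BoundedC3 a b B f) {k : ℕ} (hk : k < 3) {t : ℝ}
    (ht : t ∈ Ioo a b) : HasDerivAt (derivOn a b f k) (derivOn a b f (k + 1) t) t := by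
  have hnhds := isOpen_Ioo.mem_nhds ht
  have hd : DifferentiableAt ℝ (iteratedDeriv k f) t := by
    have h := hf.1.differentiableOn_iteratedDerivWithin (m := k) (by exact_mod_cast hk)
      isOpen_Ioo.uniqueDiffOn
    refine (h.differentiableAt hnhds).congr_of_eventuallyEq ?_
    exact Filter.eventuallyEq_of_mem hnhds (iteratedDerivWithin_of_isOpen isOpen_Ioo).symm
  rw [derivOn_of_mem ht, iteratedDeriv_succ]
  refine hd.hasDerivAt.congr_of_eventuallyEq ?_
  exact Filter.eventuallyEq_of_mem hnhds fun s hs => derivOn_of_mem hs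

theorem BoundedC3.abs_derivOn_le (hf : BoundedC3 a b B f) {k : ℕ} (hk : k ≤ 3) {t : ℝ}
    (ht : t ∈ Ioo a b) : |derivOn a b f k t| ≤ B := by
  rw [derivOn_of_mem ht]
  exact hf.2 k hk t ht

end DerivOn

/-- Derivatives of a matrix that is diagonal up to entries of order `1 / n`. -/
theorem isDerivFamily_diagonal_add {ι : Type*} [Fintype ι] [DecidableEq ι] {a b K : ℝ}
    (hι : 0 < Fintype.card ι) {w : ι → ℝ → ℝ} {P : ι → ι → ℝ → ℝ} (hw : ∀ i, BoundedC3 a b K (w i))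
    (hP : ∀ i j, BoundedC3 a b (K / Fintype.card ι) (P i j)) :
    IsDerivFamily a b (2 * K) fun k t =>
      diagonal (fun i => derivOn a b (w i) k t) + Matrix.of fun i j => derivOn a b (P i j) k t := by
  have hn : (1 : ℝ) ≤ Fintype.card ι := by exact_mod_cast hι
  refine ⟨fun k i j => ?_, fun k hk t ht i j => ?_, fun k hk t ht i => ?_,
    fun k hk t ht i j hij => ?_⟩
  · simp only [Matrix.add_apply, diagonal_apply, Matrix.of_apply]
    refine Measurable.add ?_ ((hP i j).measurable_derivOn k)
    by_cases h : i = j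
    · simp only [h, if_true]; exact (hw j).measurable_derivOn k
    · simp only [h, if_false]; exact measurable_const
  · simp only [Matrix.add_apply, diagonal_apply, Matrix.of_apply]
    refine HasDerivAt.add ?_ ((hP i j).hasDerivAt_derivOn hk ht)
    by_cases h : i = j
    · simp only [h, if_true]; exact (hw j).hasDerivAt_derivOn hk ht
    · simp only [h, if_false]; exact hasDerivAt_const _ _
  · simp only [Matrix.add_apply, diagonal_apply_eq, Matrix.of_apply]
    have h1 := (hw i).abs_derivOn_le hk ht
    have h2 := (hP i i).abs_derivOn_le hk ht
    have hK : 0 ≤ K := (abs_nonneg _).trans h1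
    have h3 : K / Fintype.card ι ≤ K := div_le_self hK hn
    exact (abs_add_le _ _).trans (by linarith)
  · simp only [Matrix.add_apply, diagonal_apply_ne _ hij, Matrix.of_apply, zero_add]
    have h1 := (hw i).abs_derivOn_le hk ht
    have hK : 0 ≤ K := (abs_nonneg _).trans h1
    refine ((hP i j).abs_derivOn_le hk ht).trans ?_
    gcongr
    linarith

/-! ### The sum of random effects and sampling errors -/

namespace IsErrorModel

variable {Ω : Type*} [MeasurableSpace Ω] {μ : Measure Ω} {m : ℕ} {D : Fin m → ℝ}
  {ψ Ke Kv M : ℝ} {v ε : Fin m → Ω → ℝ}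

theorem indepFun_v_ε (h : IsErrorModel μ D ψ Ke Kv M v ε) (i : Fin m) :
    IndepFun (v i) (ε i) μ :=
  h.indep.indepFun (i := Sum.inl i) (j := Sum.inr i) (by simp)

/-- The blocks `{vᵢ, εᵢ : i ∈ S}` and `{v_k, ε_k}` are disjoint subfamilies of the `2m` independent
variables. -/
theorem indepFun_sum (h : IsErrorModel μ D ψ Ke Kv M v ε) (S : Finset (Fin m)) (k : Fin m)
    (hk : k ∉ S) :
    IndepFun (fun ω (i : S) => v i ω + ε i ω) (fun ω => v k ω + ε k ω) μ := by
  classical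
  have hm : ∀ i, Measurable (Sum.elim v ε i) := by
    rintro (i | i)
    · exact h.measurable_v i
    · exact h.measurable_ε i
  have hd : Disjoint (S.disjSum S) (({k} : Finset (Fin m)).disjSum {k}) := by
    rw [Finset.disjoint_left]
    rintro (i | i) hi hi'
    · rw [Finset.inl_mem_disjSum] at hi hi'
      exact hk (Finset.mem_singleton.1 hi' ▸ hi)
    · rw [Finset.inr_mem_disjSum] at hi hi'
      exact hk (Finset.mem_singleton.1 hi' ▸ hi)
  have h1 := h.indep.indepFun_finset _ _ hd hm
  have h2 := h1.comp
    (φ := fun x (i : S) => x ⟨Sum.inl i.1, Finset.inl_mem_disjSum.2 i.2⟩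
      + x ⟨Sum.inr i.1, Finset.inr_mem_disjSum.2 i.2⟩)
    (ψ := fun x => x ⟨Sum.inl k, Finset.inl_mem_disjSum.2 (Finset.mem_singleton_self k)⟩
      + x ⟨Sum.inr k, Finset.inr_mem_disjSum.2 (Finset.mem_singleton_self k)⟩)
    (by fun_prop) (by fun_prop)
  simpa only [Function.comp_def, Sum.elim_inl, Sum.elim_inr] using h2

theorem integral_pow_mul_pow (h : IsErrorModel μ D ψ Ke Kv M v ε) (i : Fin m) (j k : ℕ) :
    ∫ ω, v i ω ^ j * ε i ω ^ k ∂μ = (∫ ω, v i ω ^ j ∂μ) * ∫ ω, ε i ω ^ k ∂μ :=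
  ((h.indepFun_v_ε i).comp (φ := fun x => x ^ j) (ψ := fun x => x ^ k) (by fun_prop)
    (by fun_prop)).integral_fun_mul_eq_mul_integral
    ((h.measurable_v i).pow_const j).aestronglyMeasurable
    ((h.measurable_ε i).pow_const k).aestronglyMeasurable

theorem integral_pow_four_v (h : IsErrorModel μ D ψ Ke Kv M v ε) (hψ : 0 < ψ) (i : Fin m) :
    ∫ ω, v i ω ^ 4 ∂μ = (Kv + 3) * ψ ^ 2 := by
  have hs : √ψ ^ 4 = ψ ^ 2 := by
    rw [show 4 = 2 * 2 from rfl, pow_mul, Real.sq_sqrt hψ.le]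
  have := h.fourth_v i
  simp only [div_pow, hs, integral_div] at this
  rw [← this, div_mul_cancel₀ _ (by positivity)]

theorem integral_pow_four_ε (h : IsErrorModel μ D ψ Ke Kv M v ε) (i : Fin m) :
    ∫ ω, ε i ω ^ 4 ∂μ = (Ke + 3) * D i ^ 2 := by
  have hD := h.D_pos i
  have hs : √(D i) ^ 4 = D i ^ 2 := by
    rw [show 4 = 2 * 2 from rfl, pow_mul, Real.sq_sqrt hD.le]
  have := h.fourth_ε i
  simp only [div_pow, hs, integral_div] at this
  rw [← this, div_mul_cancel₀ _ (by positivity)]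

variable [IsProbabilityMeasure μ]

theorem integrable_pow_mul_pow (h : IsErrorModel μ D ψ Ke Kv M v ε) (i : Fin m) {j k : ℕ}
    (hj : j ≤ 6) (hk : k ≤ 6) : Integrable (fun ω => v i ω ^ j * ε i ω ^ k) μ :=
  ((h.indepFun_v_ε i).comp (φ := fun x => x ^ j) (ψ := fun x => x ^ k) (by fun_prop)
    (by fun_prop)).integrable_mul (integrable_pow_of_memLp_six (h.memLp_v i) hj)
    (integrable_pow_of_memLp_six (h.memLp_ε i) hk)

theorem integral_sum_sq (h : IsErrorModel μ D ψ Ke Kv M v ε) (i : Fin m) :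
    ∫ ω, (v i ω + ε i ω) ^ 2 ∂μ = ψ + D i := by
  have h1 := integrable_pow_of_memLp_six (h.memLp_v i) (k := 2) (by norm_num)
  have h2 := (h.integrable_pow_mul_pow i (j := 1) (k := 1) (by norm_num)
    (by norm_num)).const_mul 2
  have h3 := integrable_pow_of_memLp_six (h.memLp_ε i) (k := 2) (by norm_num)
  calc _ = ∫ ω, (v i ω ^ 2 + 2 * (v i ω ^ 1 * ε i ω ^ 1) + ε i ω ^ 2) ∂μ :=
        integral_congr_ae (ae_of_all _ fun ω => by ring)
    _ = _ := by
        rw [integral_add (h1.fun_add h2) h3, integral_add h1 h2, integral_const_mul,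
          h.integral_pow_mul_pow, h.var_v, h.var_ε]
        simp only [pow_one, h.mean_v]
        ring

theorem integral_sum_pow_four (h : IsErrorModel μ D ψ Ke Kv M v ε) (hψ : 0 < ψ) (i : Fin m) :
    ∫ ω, (v i ω + ε i ω) ^ 4 ∂μ = (Kv + 3) * ψ ^ 2 + 6 * (ψ * D i) + (Ke + 3) * D i ^ 2 := by
  have h1 := integrable_pow_of_memLp_six (h.memLp_v i) (k := 4) (by norm_num)
  have h2 := (h.integrable_pow_mul_pow i (j := 3) (k := 1) (by norm_num)
    (by norm_num)).const_mul 4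
  have h3 := (h.integrable_pow_mul_pow i (j := 2) (k := 2) (by norm_num)
    (by norm_num)).const_mul 6
  have h4 := (h.integrable_pow_mul_pow i (j := 1) (k := 3) (by norm_num)
    (by norm_num)).const_mul 4
  have h5 := integrable_pow_of_memLp_six (h.memLp_ε i) (k := 4) (by norm_num)
  calc _ = ∫ ω, (v i ω ^ 4 + 4 * (v i ω ^ 3 * ε i ω ^ 1) + 6 * (v i ω ^ 2 * ε i ω ^ 2)
          + 4 * (v i ω ^ 1 * ε i ω ^ 3) + ε i ω ^ 4) ∂μ :=
        integral_congr_ae (ae_of_all _ fun ω => by ring)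
    _ = _ := by
        rw [integral_add (((h1.fun_add h2).fun_add h3).fun_add h4) h5,
          integral_add ((h1.fun_add h2).fun_add h3) h4, integral_add (h1.fun_add h2) h3,
          integral_add h1 h2, integral_const_mul, integral_const_mul, integral_const_mul]
        simp only [h.integral_pow_mul_pow]
        simp only [pow_one, h.mean_v, h.mean_ε, h.var_v, h.var_ε,
          h.integral_pow_four_v hψ, h.integral_pow_four_ε]
        ring

/-- The Gaussian parts of the fourth moments combine to `3ψ² + 6ψDᵢ + 3Dᵢ² = 3(ψ + Dᵢ)²`, of which
one copy is removed by centring; the kurtoses remain additively. -/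
theorem integral_sum_sq_sub_sq (h : IsErrorModel μ D ψ Ke Kv M v ε) (hψ : 0 < ψ) (i : Fin m) :
    ∫ ω, ((v i ω + ε i ω) ^ 2 - (ψ + D i)) ^ 2 ∂μ
      = 2 * (ψ + D i) ^ 2 + (Ke * D i ^ 2 + ψ ^ 2 * Kv) := by
  have hu := (h.memLp_v i).add (h.memLp_ε i)
  have h4 := integrable_pow_of_memLp_six hu (k := 4) (by norm_num)
  have h2 := (integrable_pow_of_memLp_six hu (k := 2) (by norm_num)).const_mul (2 * (ψ + D i))
  have h0 := h4.sub h2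
  simp only [Pi.sub_def, Pi.add_apply] at h0 h2 h4
  calc _ = ∫ ω, ((v i ω + ε i ω) ^ 4 - 2 * (ψ + D i) * (v i ω + ε i ω) ^ 2
          + (ψ + D i) ^ 2) ∂μ := integral_congr_ae (ae_of_all _ fun ω => by ring)
    _ = _ := by
        rw [integral_add h0 (integrable_const _), integral_sub h4 h2, integral_const_mul,
          h.integral_sum_sq, h.integral_sum_pow_four hψ]
        simp only [integral_const, probReal_univ, smul_eq_mul]
        ring

/-- The constant comes from `(x + y)⁶ ≤ 32 (x⁶ + y⁶)` and two sixth moments; `|M|` keeps it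
nonnegative for every `m`. -/
theorem isCenteredFamily (h : IsErrorModel μ D ψ Ke Kv M v ε) :
    IsCenteredFamily μ (fun i ω => v i ω + ε i ω) (fun i => ψ + D i) (64 * |M|) where
  measurable i := (h.measurable_v i).add (h.measurable_ε i)
  indep := h.indepFun_sum
  memLp i := (h.memLp_v i).add (h.memLp_ε i)
  mean i := by
    rw [integral_add ((h.memLp_v i).integrable (by norm_num))
      ((h.memLp_ε i).integrable (by norm_num)), h.mean_v, h.mean_ε, add_zero]
  var := h.integral_sum_sq
  sixth i := by
    have h1 := integrable_pow_six (h.memLp_v i)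
    have h2 := integrable_pow_six (h.memLp_ε i)
    have h3 := integrable_pow_six ((h.memLp_v i).add (h.memLp_ε i))
    calc _ ≤ ∫ ω, 32 * (v i ω ^ 6 + ε i ω ^ 6) ∂μ := by
          refine integral_mono h3 ((h1.add h2).const_mul _) fun ω => ?_
          have := add_pow_le (abs_nonneg (v i ω)) (abs_nonneg (ε i ω)) 6
          have e : ∀ x : ℝ, |x| ^ 6 = x ^ 6 := (even_two_mul 3).pow_abs
          have h4 := pow_le_pow_left₀ (abs_nonneg _) (abs_add_le (v i ω) (ε i ω)) 6
          simp only [e] at this h4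
          norm_num at this
          exact h4.trans this
      _ = 32 * (∫ ω, v i ω ^ 6 ∂μ + ∫ ω, ε i ω ^ 6 ∂μ) := by
          rw [integral_const_mul, integral_add h1 h2]
      _ ≤ 64 * |M| := by
          have := h.sixth_v i
          have := h.sixth_ε i
          have := le_abs_self M
          linarith

end IsErrorModel

/-! ### The matrix of the estimating equation -/

/-- The entries of `(1 - N)ᵀ W (1 - N) - W` for `W = diag w`. -/
def perturbation {ι : Type*} [Fintype ι] (N : ℝ → Matrix ι ι ℝ) (w : ι → ℝ → ℝ) (i j : ι)
    (t : ℝ) : ℝ :=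
  -(w i t * N t i j) + -(N t j i * w j t) + ∑ k, N t k i * w k t * N t k j

theorem transpose_one_sub_mul_diagonal_mul {ι : Type*} [Fintype ι] [DecidableEq ι]
    (N : ℝ → Matrix ι ι ℝ) (w : ι → ℝ → ℝ) (t : ℝ) :
    (1 - N t)ᵀ * diagonal (fun i => w i t) * (1 - N t)
      = diagonal (fun i => w i t) + Matrix.of fun i j => perturbation N w i j t := by
  have h : (1 - N t)ᵀ * diagonal (fun i => w i t) * (1 - N t)
      = diagonal (fun i => w i t) + (-(diagonal (fun i => w i t) * N t)
        + -((N t)ᵀ * diagonal fun i => w i t) + (N t)ᵀ * diagonal (fun i => w i t) * N t) := by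
    rw [transpose_sub, transpose_one]
    noncomm_ring
  rw [h]
  congr 1
  ext i j
  simp only [Matrix.add_apply, Matrix.neg_apply, diagonal_mul, mul_diagonal, transpose_apply,
    Matrix.of_apply, perturbation]
  rw [Matrix.mul_apply]
  simp only [mul_diagonal, transpose_apply]

/-- Each of the two linear terms contributes `8B²/n`. A summand of the last term is a double
product, bounded by `64B³/n²`, and there are `n` of them, so the order `1/n` survives the summation.
-/
theorem boundedC3_perturbation {ι : Type*} [Fintype ι] {a b B : ℝ} {N : ℝ → Matrix ι ι ℝ}
    {w : ι → ℝ → ℝ} (hι : 0 < Fintype.card ι) (hw : ∀ i, BoundedC3 a b B (w i))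
    (hN : ∀ i j, BoundedC3 a b (B / Fintype.card ι) fun t => N t i j) (i j : ι) :
    BoundedC3 a b ((16 * B ^ 2 + 64 * B ^ 3) / Fintype.card ι) (perturbation N w i j) := by
  have hn : (Fintype.card ι : ℝ) ≠ 0 := by exact_mod_cast hι.ne'
  have h := (((hw i).mul (hN i j)).neg.add ((hN j i).mul (hw j)).neg).add
    (BoundedC3.sum (S := Finset.univ) fun k _ => ((hN k i).mul (hw k)).mul (hN k j))
  refine h.mono (le_of_eq ?_)
  rw [Finset.card_univ]
  field_simp
  ring

section EstimatingEquation

variable {m p : ℕ} {X : Matrix (Fin m) (Fin p) ℝ} {L : ℝ → Matrix (Fin p) (Fin m) ℝ}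
  {W : ℝ → Matrix (Fin m) (Fin m) ℝ} {t : ℝ}

theorem quadMatrix_eq (hW : (W t).IsDiag) : quadMatrix X L W t = diagonal (fun i => W t i i)
    + Matrix.of fun i j => perturbation (fun t => X * L t) (fun i t => W t i i) i j t := by
  rw [← transpose_one_sub_mul_diagonal_mul (fun t => X * L t) (fun i t => W t i i) t]
  have : diagonal (fun i => W t i i) = W t := hW.diagonal_diag
  rw [this]
  rfl

theorem residualMatrix_mul {L : Matrix (Fin p) (Fin m) ℝ} (h : L * X = 1) :
    residualMatrix X L * X = 0 := by
  rw [residualMatrix, Matrix.sub_mul, Matrix.mul_assoc, h, Matrix.mul_one, Matrix.one_mul, sub_self]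

theorem quadForm_add_mulVec (h : L t * X = 1) (β : Fin p → ℝ) (x : Fin m → ℝ) :
    (X *ᵥ β + x) ⬝ᵥ (quadMatrix X L W t *ᵥ (X *ᵥ β + x)) = x ⬝ᵥ (quadMatrix X L W t *ᵥ x) := by
  have h1 : quadMatrix X L W t * X = 0 := by
    rw [quadMatrix, Matrix.mul_assoc, residualMatrix_mul h, Matrix.mul_zero]
  have h2 : Xᵀ * quadMatrix X L W t = 0 := by
    rw [quadMatrix, ← Matrix.mul_assoc, ← Matrix.mul_assoc, ← transpose_mul, residualMatrix_mul h,
      transpose_zero, Matrix.zero_mul, Matrix.zero_mul]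
  rw [mulVec_add, mulVec_mulVec, h1, zero_mulVec, zero_add, add_dotProduct, dotProduct_mulVec,
    ← vecMul_transpose, vecMul_vecMul, h2, vecMul_zero, zero_dotProduct, zero_add]

theorem trace_mul_sigma (A : Matrix (Fin m) (Fin m) ℝ) (D : Fin m → ℝ) (t : ℝ) :
    (A * sigma D t).trace = t * A.trace + ∑ i, A i i * D i := by
  rw [sigma, Matrix.mul_add, trace_add, Matrix.mul_smul, Matrix.mul_one, trace_smul, smul_eq_mul]
  congr 1
  simp [Matrix.trace, mul_diagonal]

theorem quadOn_univ_eq (A : Matrix (Fin m) (Fin m) ℝ) (D : Fin m → ℝ) (ψ : ℝ) (x : Fin m → ℝ) :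
    quadOn (fun i => ψ + D i) A Finset.univ x
      = x ⬝ᵥ (A *ᵥ x) - (ψ * A.trace + ∑ i, A i i * D i) := by
  simp only [quadOn, dotProduct, mulVec, Finset.mul_sum, Matrix.trace, diag_apply, mul_add,
    Finset.sum_add_distrib]
  congr 1
  · exact Finset.sum_congr rfl fun i _ => Finset.sum_congr rfl fun j _ => by ring
  · congr 1
    exact Finset.sum_congr rfl fun i _ => mul_comm _ _

/-- Changing `Σ(t)` to `Σ(ψ)` in the centring moves `(t - ψ) tr A(t)` to the other side. This gives
the form of the equation to which the root expansion applies. -/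
theorem quadOn_eq_of_estimatingFunction_eq_zero {Ω : Type*} {D : Fin m → ℝ} {β : Fin p → ℝ}
    {v ε : Fin m → Ω → ℝ} {ω : Ω} (hX : L t * X = 1)
    (h : estimatingFunction D X L W (observation X β v ε ω) t = 0) (ψ : ℝ) :
    quadOn (fun i => ψ + D i) (quadMatrix X L W t) Finset.univ (fun i => v i ω + ε i ω)
      = (t - ψ) * (quadMatrix X L W t).trace := by
  have e : observation X β v ε ω = X *ᵥ β + fun i => v i ω + ε i ω := by
    rw [observation, add_assoc]; rfl
  rw [estimatingFunction, e, quadForm_add_mulVec hX, trace_mul_sigma] at h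
  rw [quadOn_univ_eq]
  linear_combination h

end EstimatingEquation

/-- Passing from `W` to `Qᵀ W Q` changes the trace by `O(1)` only, so its order `m` is kept for
large `m`. -/
theorem abs_sum_sub_le_abs_trace {ι : Type*} [Fintype ι] [DecidableEq ι] {w : ι → ℝ}
    {P : Matrix ι ι ℝ} {K : ℝ} (hι : 0 < Fintype.card ι)
    (hP : ∀ i j, |P i j| ≤ K / Fintype.card ι) : |∑ i, w i| - K ≤ |(diagonal w + P).trace| := by
  have hn : (Fintype.card ι : ℝ) ≠ 0 := by exact_mod_cast hι.ne'
  have h : |P.trace| ≤ K := by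
    calc |P.trace| ≤ ∑ i, |P i i| := Finset.abs_sum_le_sum_abs _ _
      _ ≤ ∑ _i : ι, K / Fintype.card ι := Finset.sum_le_sum fun i _ => hP i i
      _ = K := by rw [Finset.sum_const, Finset.card_univ, nsmul_eq_mul, mul_div_cancel₀ _ hn]
  rw [trace_add, trace_diagonal]
  have := abs_sub_abs_le_abs_sub (∑ i, w i) (-P.trace)
  rw [abs_neg, sub_neg_eq_add] at this
  linarith

/-! ### The closed formulas -/

section Formulas

variable {m : ℕ} {D : Fin m → ℝ} {ψ Ke Kv : ℝ} {W : ℝ → Matrix (Fin m) (Fin m) ℝ}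

theorem sigma_eq_diagonal (D : Fin m → ℝ) (t : ℝ) : sigma D t = diagonal fun i => t + D i := by
  rw [sigma, smul_one_eq_diagonal, diagonal_add]

theorem asymptoticVariance_eq {w : Fin m → ℝ} (hW : W ψ = diagonal w) :
    asymptoticVariance D ψ Ke Kv W
      = (∑ i, w i * w i * (2 * (ψ + D i) ^ 2 + (Ke * D i ^ 2 + ψ ^ 2 * Kv)))
        / (∑ i, w i) ^ 2 := by
  rw [asymptoticVariance, hW, sigma_eq_diagonal]
  simp only [pow_two, diagonal_mul_diagonal, trace_diagonal]
  rw [← add_div]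
  congr 1
  simp only [Finset.mul_sum, ← Finset.sum_add_distrib]
  exact Finset.sum_congr rfl fun i _ => by ring

theorem secondOrderBias_eq {w w₁ : Fin m → ℝ} (hW : W ψ = diagonal w)
    (hW₁ : entryDeriv W ψ = diagonal w₁) (h0 : ∑ i, w i ≠ 0) :
    secondOrderBias D ψ Ke Kv W
      = (∑ i, w i * w₁ i * (2 * (ψ + D i) ^ 2 + (Ke * D i ^ 2 + ψ ^ 2 * Kv))) / (∑ i, w i) ^ 2
        - (∑ i, w i * w i * (2 * (ψ + D i) ^ 2 + (Ke * D i ^ 2 + ψ ^ 2 * Kv)))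
          * (∑ i, w₁ i) / (∑ i, w i) ^ 3 := by
  have e : ∀ f g : Fin m → ℝ,
      ∑ i, f i * g i * (2 * (ψ + D i) ^ 2 + (Ke * D i ^ 2 + ψ ^ 2 * Kv))
        = 2 * (∑ i, g i * (ψ + D i) * f i * (ψ + D i))
          + (Ke * (∑ i, g i * f i * (D i * D i)) + ψ ^ 2 * Kv * ∑ i, g i * f i) := by
    intro f g
    simp only [Finset.mul_sum, ← Finset.sum_add_distrib]
    exact Finset.sum_congr rfl fun i _ => by ring
  rw [e, e, secondOrderBias, hW, hW₁, sigma_eq_diagonal]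
  simp only [pow_two (Matrix.diagonal _), diagonal_mul_diagonal, trace_diagonal]
  field_simp
  ring

/-- Diagonality on a neighbourhood of `ψ` is what makes the off-diagonal derivatives vanish. -/
theorem entryDeriv_eq_diagonal {a b : ℝ} (hW : ∀ t ∈ Ioo a b, (W t).IsDiag) (hψ : ψ ∈ Ioo a b) :
    entryDeriv W ψ = diagonal fun i => deriv (fun t => W t i i) ψ := by
  ext i j
  rw [entryDeriv, Matrix.of_apply, diagonal_apply]
  split_ifs with h
  · rw [h]
  · have : (fun t => W t i j) =ᶠ[nhds ψ] fun _ => 0 :=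
      Filter.eventuallyEq_of_mem (isOpen_Ioo.mem_nhds hψ) fun t ht => hW t ht h
    rw [this.deriv_eq, deriv_const]

end Formulas

theorem rpow_neg_three_halves {x : ℝ} (hx : 0 ≤ x) : x ^ (-(3 / 2) : ℝ) = 1 / √x ^ 3 := by
  rw [Real.rpow_neg hx, one_div, Real.sqrt_eq_rpow, ← Real.rpow_natCast, ← Real.rpow_mul hx]
  norm_num

end FayHerriot

/-! ### The theorem -/

theorem proposition3
    -- fixed constants: dimension of the regression, true parameter, kurtoses, bounds
    (p : ℕ) (ψ Ke Kv a b M B c : ℝ) (hψ : 0 < ψ) (hψab : ψ ∈ Ioo a b) (hc : 0 < c)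
    -- for each number of areas `m`: the data of the model
    (D : (m : ℕ) → Fin m → ℝ)
    (X : (m : ℕ) → Matrix (Fin m) (Fin p) ℝ)
    (β : ℕ → Fin p → ℝ)
    (L : (m : ℕ) → ℝ → Matrix (Fin p) (Fin m) ℝ)
    (W : (m : ℕ) → ℝ → Matrix (Fin m) (Fin m) ℝ)
    {Ω : ℕ → Type*} [∀ m, MeasurableSpace (Ω m)]
    (μ : (m : ℕ) → Measure (Ω m)) [∀ m, IsProbabilityMeasure (μ m)]
    (v ε : (m : ℕ) → Fin m → Ω m → ℝ)
    (ψhat : (m : ℕ) → Ω m → ℝ)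
    -- random effects and sampling errors
    (hmodel : ∀ᶠ m in atTop, FayHerriot.IsErrorModel (μ m) (D m) ψ Ke Kv M (v m) (ε m))
    -- `L y` is a linear unbiased estimator of `β`, and `(X L)ᵢⱼ = O(1/m)` with its derivatives
    (hLX : ∀ᶠ m in atTop, ∀ t ∈ Ioo a b, L m t * X m = 1)
    (hXL : ∀ᶠ m : ℕ in atTop, ∀ i j,
      FayHerriot.BoundedC3 a b (B / m) (fun t => (X m * L m t) i j))
    -- the weight matrix is diagonal, bounded with its derivatives, with trace of order `m`
    (hWdiag : ∀ᶠ m in atTop, ∀ t ∈ Ioo a b, (W m t).IsDiag)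
    (hW : ∀ᶠ m in atTop, ∀ i, FayHerriot.BoundedC3 a b B (fun t => W m t i i))
    (hWtrace : ∀ᶠ m : ℕ in atTop, ∀ t ∈ Ioo a b, c * m ≤ |(W m t).trace|)
    -- the estimator solves the estimating equation in `(a, b)`, up to a negligible event
    (hψhat : ∀ᶠ m in atTop, Measurable (ψhat m))
    (hsol : ∃ C : ℝ, ∀ᶠ m : ℕ in atTop,
      ∫⁻ ω in {ω | ¬ (ψhat m ω ∈ Ioo a b ∧
          FayHerriot.estimatingFunction (D m) (X m) (L m) (W m)
            (FayHerriot.observation (X m) (β m) (v m) (ε m) ω) (ψhat m ω) = 0)},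
        ENNReal.ofReal (1 + (ψhat m ω) ^ 2) ∂(μ m)
        ≤ ENNReal.ofReal (C * (m : ℝ) ^ (-(3 / 2) : ℝ))) :
    (∀ᶠ m in atTop, MemLp (ψhat m) 2 (μ m)) ∧
    (fun m : ℕ => variance (ψhat m) (μ m)
        - FayHerriot.asymptoticVariance (D m) ψ Ke Kv (W m))
      =O[atTop] (fun m : ℕ => (m : ℝ) ^ (-(3 / 2) : ℝ)) ∧
    (fun m : ℕ => (∫ ω, (ψhat m ω - ψ) ∂(μ m))
        - FayHerriot.secondOrderBias (D m) ψ Ke Kv (W m))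
      =O[atTop] (fun m : ℕ => (m : ℝ) ^ (-(3 / 2) : ℝ)) := by
  obtain ⟨Q, hsol⟩ := hsol
  -- The first summand bounds the weights, the rest the perturbation entries times `m`. Absolute
  -- values are used because `B ≥ 0` is known only once some `m > 0` satisfies the bounds.
  set K : ℝ := |B| + (16 * B ^ 2 + 64 * |B| ^ 3) with hK_def
  have hK : 0 ≤ K := by positivity
  -- `2 * K` allows for a diagonal entry plus its perturbation. The lower bound on the trace drops
  -- from `c` to `c / 2`, the difference absorbing the perturbation as soon as `m ≥ 2K/c`.
  obtain ⟨C, hC, hmain⟩ := FayHerriot.root_bias_variance (K := 2 * K) (M := 64 * |M|)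
    (Q := max Q 0) (half_pos hc) (by positivity) (by positivity) (le_max_right _ _) hψab
  have hlarge : ∀ᶠ m : ℕ in atTop, 2 * K / c ≤ m :=
    tendsto_natCast_atTop_atTop.eventually_ge_atTop _
  have key : ∀ᶠ m : ℕ in atTop, MemLp (ψhat m) 2 (μ m) ∧
      |(∫ ω, (ψhat m ω - ψ) ∂(μ m)) - FayHerriot.secondOrderBias (D m) ψ Ke Kv (W m)|
        ≤ C / √(m : ℝ) ^ 3 ∧
      |variance (ψhat m) (μ m) - FayHerriot.asymptoticVariance (D m) ψ Ke Kv (W m)|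
        ≤ C / √(m : ℝ) ^ 3 := by
    filter_upwards [hmodel, hLX, hXL, hWdiag, hW, hWtrace, hψhat, hsol, hlarge,
      eventually_gt_atTop 0] with m hmodel hLX hXL hWdiag hW hWtrace hψhat hsol hlarge hm
    have hm' : (0 : ℝ) < m := by exact_mod_cast hm
    have hcard : 0 < Fintype.card (Fin m) := by simpa using hm
    have hB : 0 ≤ B := (abs_nonneg _).trans ((hW ⟨0, hm⟩).2 0 (by norm_num) ψ hψab)
    have hBK : B ≤ K := (le_abs_self B).trans (le_add_of_nonneg_right (by positivity))
    have hBK' : 16 * B ^ 2 + 64 * B ^ 3 ≤ K := by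
      rw [hK_def, abs_of_nonneg hB]; linarith
    set P := FayHerriot.perturbation (fun t => X m * L m t) fun i t => W m t i i with hP_def
    have hPC : ∀ i j, FayHerriot.BoundedC3 a b (K / Fintype.card (Fin m)) (P i j) := fun i j =>
      (FayHerriot.boundedC3_perturbation hcard hW (by simpa using hXL) i j).mono (by gcongr)
    have hwC : ∀ i, FayHerriot.BoundedC3 a b K fun t => W m t i i := fun i => (hW i).mono hBK
    have hA := FayHerriot.isDerivFamily_diagonal_add hcard hwC hPC
    set A : ℕ → ℝ → Matrix (Fin m) (Fin m) ℝ := fun k t =>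
      diagonal (fun i => FayHerriot.derivOn a b (fun t => W m t i i) k t)
        + Matrix.of fun i j => FayHerriot.derivOn a b (P i j) k t with hA_def
    have hA0 : ∀ t ∈ Ioo a b, A 0 t = FayHerriot.quadMatrix (X m) (L m) (W m) t := fun t ht => by
      rw [FayHerriot.quadMatrix_eq (hWdiag t ht)]
      simp only [hA_def, FayHerriot.derivOn_of_mem ht, iteratedDeriv_zero, hP_def]
    have htr : ∀ t ∈ Ioo a b,
        c * m ≤ |∑ i, FayHerriot.derivOn a b (fun t => W m t i i) 0 t| := fun t ht => by
      simp only [FayHerriot.derivOn_of_mem ht, iteratedDeriv_zero]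
      exact hWtrace t ht
    have hPle : ∀ k ≤ 3, ∀ t ∈ Ioo a b, ∀ i j,
        |(Matrix.of fun i j => FayHerriot.derivOn a b (P i j) k t) i j|
          ≤ K / Fintype.card (Fin m) := fun k hk t ht i j => (hPC i j).abs_derivOn_le hk ht
    have hPle' : ∀ k ≤ 3, ∀ i j,
        |(Matrix.of fun i j => FayHerriot.derivOn a b (P i j) k ψ) i j| ≤ 2 * K / m :=
      fun k hk i j => (hPle k hk ψ hψab i j).trans (by
        rw [Fintype.card_fin]; gcongr; linarith)
    have hKm : K ≤ c / 2 * m := by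
      rw [div_le_iff₀ hc] at hlarge
      linarith
    have h := hmain (μ m) m (fun i ω => v m i ω + ε m i ω) (fun i => ψ + D m i) A (ψhat m) _
      (fun i => FayHerriot.derivOn a b (fun t => W m t i i) 0 ψ)
      (fun i => FayHerriot.derivOn a b (fun t => W m t i i) 1 ψ) _ _ hm hmodel.isCenteredFamily hA
      (fun t ht => by
        have := FayHerriot.abs_sum_sub_le_abs_trace
          (w := fun i => FayHerriot.derivOn a b (fun t => W m t i i) 0 t) hcard
          (hPle 0 (by norm_num) t ht)
        exact le_trans (by linarith [htr t ht]) this)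
      hψhat
      (fun ω hω => by
        obtain ⟨h1, h2⟩ := not_not.1 hω
        refine ⟨h1, ?_⟩
        rw [hA0 _ h1]
        exact FayHerriot.quadOn_eq_of_estimatingFunction_eq_zero (hLX _ h1) h2 ψ)
      (hsol.trans (ENNReal.ofReal_le_ofReal (by
        rw [FayHerriot.rpow_neg_three_halves hm'.le, mul_one_div]
        gcongr
        exact le_max_left _ _)))
      rfl rfl
      (fun i => ((hwC i).abs_derivOn_le (by norm_num) hψab).trans (by linarith))
      (fun i => ((hwC i).abs_derivOn_le (by norm_num) hψab).trans (by linarith))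
      (hPle' 0 (by norm_num)) (hPle' 1 (by norm_num))
      (le_trans (by nlinarith) (htr ψ hψab))
    simp only [FayHerriot.derivOn_of_mem hψab, iteratedDeriv_zero, iteratedDeriv_one,
      hmodel.integral_sum_sq_sub_sq hψ] at h
    have hWψ : W m ψ = diagonal fun i => W m ψ i i := (hWdiag ψ hψab).diagonal_diag.symm
    have hne : ∑ i, W m ψ i i ≠ 0 := by
      have h1 : c * m ≤ |∑ i, W m ψ i i| := hWtrace ψ hψab
      exact abs_pos.1 ((mul_pos hc hm').trans_le h1)
    rw [FayHerriot.asymptoticVariance_eq hWψ, FayHerriot.secondOrderBias_eq hWψ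
      (FayHerriot.entryDeriv_eq_diagonal hWdiag hψab) hne]
    exact h
  have hrate : ∀ m : ℕ, C / √(m : ℝ) ^ 3 = C * ‖(m : ℝ) ^ (-(3 / 2) : ℝ)‖ := fun m => by
    rw [FayHerriot.rpow_neg_three_halves m.cast_nonneg, Real.norm_of_nonneg (by positivity),
      mul_one_div]
  refine ⟨key.mono fun m h => h.1, IsBigO.of_bound C (key.mono fun m h => ?_),
    IsBigO.of_bound C (key.mono fun m h => ?_)⟩
  · rw [Real.norm_eq_abs, ← hrate]; exact h.2.2
  · rw [Real.norm_eq_abs, ← hrate]; exact h.2.1
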